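/- Let $T$ be an NTP$_2$ theory, let $G$ be a group definable (with parameters) in a model $M$ of $T$, let $H$ be a normal solvable subgroup of $G$ of class (derived length) at most $n$, and let $\mathfrak G$ be an $|H|^+$-saturated extension of $G$, that is, the group defined by the same formulas in an $|H|^+$-saturated elementary extension $N$ of $M$. Then there is a subgroup $S$ of $\mathfrak G$, definable with parameters from $N$, normal in $\mathfrak G$ and containing $H$, which is almost solvable of class at most $n$. Moreover, $S$ admits a definable almost series of length $n$ all of whose members are normal in $\mathfrak G$: there are subgroups $\{1\}=S_0\le S_1\le\dots\le S_n=S$, definable with parameters from $N$ and normal in $\mathfrak G$, such that $S_{i+1}/S_i$ is almost abelian for all $i<n$. Here a group is almost abelian if the centralizer of each of its elements has finite index. A group $K$ is almost solvable if it has an almost series, i.e. a finite chain $\{1\}=K_0\le K_1\le\dots\le K_m=K$ of normal subgroups of $K$ with all $K_{i+1}/K_i$ almost abelian; the least such $m$ is its almost solvable class. A theory is NTP$_2$ if in none of its models there are a formula $\psi(\bar x;\bar y)$, an array of parameters $(\bar a_{i,j})_{i,j\in\omega}$ and $k\in\omega$ such that $\{\psi(\bar x;\bar a_{i,j}):j\in\omega\}$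 is $k$-inconsistent for every $i$ and $\{\psi(\bar x;\bar a_{i,f(i)}):i\in\omega\}$ is consistent for every $f:\omega\to\omega$. -/

import Mathlib

open FirstOrder

universe u v w

/-! ### The tree property of the second kind -/

/-- The theory `T` has TP₂: in some model of `T` there are a formula `ψ(x; y)` (with `x`, `y` finite
tuples of variables), an array `(a i j)` of parameters and a natural number `k` such that every row
`{ψ(x; a i j) : j}` is `k`-inconsistent and every path `{ψ(x; a i (f i)) : i}` is consistent. Here
`k`-inconsistent means that no `k` members with distinct indices have a common solution, and
consistent (with the elementary diagram of the model) means that any finitely many members have a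
common solution in the model. -/
def FirstOrder.Language.Theory.HasTP2 {L : FirstOrder.Language.{u, v}} (T : L.Theory) : Prop :=
  ∃ (M : FirstOrder.Language.Theory.ModelType.{u, v, max u v} T) (p q : ℕ) (ψ : L.Formula (Fin p ⊕ Fin q))
    (a : ℕ → ℕ → Fin q → M) (k : ℕ),
    (∀ (i : ℕ) (s : Finset ℕ), s.card = k →
      ¬ ∃ x : Fin p → M, ∀ j ∈ s, ψ.Realize (Sum.elim x (a i j))) ∧
    (∀ (f : ℕ → ℕ) (s : Finset ℕ),
      ∃ x : Fin p → M, ∀ i ∈ s, ψ.Realize (Sum.elim x (a i (f i))))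

/-- A theory is NTP₂ if it does not have TP₂. -/
def FirstOrder.Language.Theory.NTP2 {L : FirstOrder.Language.{u, v}} (T : L.Theory) : Prop :=
  ¬ T.HasTP2

/-! ### Saturation -/

/-- `N` is `κ`-saturated: for every set `A` of fewer than `κ` parameters from `N`, every set of
formulas over `A` in finitely many variables that is finitely satisfiable in `N` is realized
in `N`. -/
def FirstOrder.Language.IsSaturated (L : FirstOrder.Language.{u, v}) (N : Type w) [L.Structure N]
    (κ : Cardinal.{w}) : Prop :=
  ∀ A : Set N, Cardinal.mk A < κ → ∀ (m : ℕ) (Φ : Set (L[[A]].Formula (Fin m))),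
    (∀ s : Finset (L[[A]].Formula (Fin m)), (s : Set (L[[A]].Formula (Fin m))) ⊆ Φ →
      ∃ x : Fin m → N, ∀ φ ∈ s, φ.Realize x) →
    ∃ x : Fin m → N, ∀ φ ∈ Φ, φ.Realize x

/-! ### Definable groups -/

/-- Formulas, with parameters from `P`, for a set of `k`-tuples and for the graph
`x * y = z` of a binary operation on it. -/
structure GroupFormulas (L : FirstOrder.Language.{u, v}) (P : Type w) (k : ℕ) where
  dom : L.Formula (P ⊕ Fin k)
  mul : L.Formula (P ⊕ (Fin k ⊕ (Fin k ⊕ Fin k)))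

namespace GroupFormulas

variable {L : FirstOrder.Language.{u, v}} {P : Type w} {k : ℕ} (Γ : GroupFormulas L P k)
variable {N : Type w} [L.Structure N]

/-- The set defined by the domain formula, with the parameters interpreted by `c`. -/
def Dom (c : P → N) (x : Fin k → N) : Prop :=
  Γ.dom.Realize (Sum.elim c x)

/-- The relation `x * y = z` given by the second formula. -/
def Mul (c : P → N) (x y z : Fin k → N) : Prop :=
  Γ.mul.Realize (Sum.elim c (Sum.elim x (Sum.elim y z)))

/-- The formulas define a group in `N` when the parameters are interpreted by `c`. -/
structure IsGroup (c : P → N) : Prop where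
  total : ∀ x, Γ.Dom c x → ∀ y, Γ.Dom c y → ∃ z, Γ.Dom c z ∧ Γ.Mul c x y z
  unique : ∀ x, Γ.Dom c x → ∀ y, Γ.Dom c y → ∀ z, Γ.Dom c z → ∀ z', Γ.Dom c z' →
    Γ.Mul c x y z → Γ.Mul c x y z' → z = z'
  assoc : ∀ x, Γ.Dom c x → ∀ y, Γ.Dom c y → ∀ z, Γ.Dom c z → ∀ s, Γ.Dom c s → ∀ t, Γ.Dom c t →
    ∀ r, Γ.Dom c r → Γ.Mul c x y s → Γ.Mul c y z t → Γ.Mul c s z r → Γ.Mul c x t r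
  one_inv : ∃ e, Γ.Dom c e ∧ ∀ x, Γ.Dom c x → Γ.Mul c e x x ∧ ∃ y, Γ.Dom c y ∧ Γ.Mul c y x e

/-- The domain formula applied to variables (with parameters and variables renamed). -/
def domF {α : Type*} (p : P → α) (x : Fin k → α) : L.Formula α :=
  Γ.dom.relabel (Sum.elim p x)

/-- The multiplication formula applied to variables. -/
def mulF {α : Type*} (p : P → α) (x y z : Fin k → α) : L.Formula α :=
  Γ.mul.relabel (Sum.elim p (Sum.elim x (Sum.elim y z)))

theorem realize_domF {α : Type*} (p : P → α) (x : Fin k → α) (e : α → N) :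
    (Γ.domF p x).Realize e ↔ Γ.Dom (e ∘ p) (e ∘ x) := by
  simp [domF, Dom, FirstOrder.Language.Formula.realize_relabel, Sum.comp_elim]

theorem realize_mulF {α : Type*} (p : P → α) (x y z : Fin k → α) (e : α → N) :
    (Γ.mulF p x y z).Realize e ↔ Γ.Mul (e ∘ p) (e ∘ x) (e ∘ y) (e ∘ z) := by
  simp [mulF, Mul, FirstOrder.Language.Formula.realize_relabel, Sum.comp_elim]

/-- By elementarity, formulas that define a group in `M` define a group in every elementary
extension of `M`. -/
theorem IsGroup.map {M : Type w} [L.Structure M] {Γ : GroupFormulas L P k} {c : P → M}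
    (h : Γ.IsGroup c) (f : M ↪ₑ[L] N) : Γ.IsGroup (f ∘ c) := by
  have key : ∀ φ : L.Formula P, φ.Realize c → φ.Realize (f ∘ c) :=
    fun φ hφ => (f.map_formula φ c).2 hφ
  let x1 : Fin k → P ⊕ Fin k := Sum.inr
  let p1 : P → P ⊕ Fin k := Sum.inl
  let i2 : P ⊕ Fin k → (P ⊕ Fin k) ⊕ Fin k := Sum.inl
  let x2 : Fin k → (P ⊕ Fin k) ⊕ Fin k := Sum.inr
  let i3 : (P ⊕ Fin k) ⊕ Fin k → ((P ⊕ Fin k) ⊕ Fin k) ⊕ Fin k := Sum.inl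
  let x3 : Fin k → ((P ⊕ Fin k) ⊕ Fin k) ⊕ Fin k := Sum.inr
  let i4 : ((P ⊕ Fin k) ⊕ Fin k) ⊕ Fin k → (((P ⊕ Fin k) ⊕ Fin k) ⊕ Fin k) ⊕ Fin k := Sum.inl
  let x4 : Fin k → (((P ⊕ Fin k) ⊕ Fin k) ⊕ Fin k) ⊕ Fin k := Sum.inr
  let i5 : (((P ⊕ Fin k) ⊕ Fin k) ⊕ Fin k) ⊕ Fin k →
    ((((P ⊕ Fin k) ⊕ Fin k) ⊕ Fin k) ⊕ Fin k) ⊕ Fin k := Sum.inl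
  let x5 : Fin k → ((((P ⊕ Fin k) ⊕ Fin k) ⊕ Fin k) ⊕ Fin k) ⊕ Fin k := Sum.inr
  let i6 : ((((P ⊕ Fin k) ⊕ Fin k) ⊕ Fin k) ⊕ Fin k) ⊕ Fin k →
    (((((P ⊕ Fin k) ⊕ Fin k) ⊕ Fin k) ⊕ Fin k) ⊕ Fin k) ⊕ Fin k := Sum.inl
  let x6 : Fin k → (((((P ⊕ Fin k) ⊕ Fin k) ⊕ Fin k) ⊕ Fin k) ⊕ Fin k) ⊕ Fin k := Sum.inr
  refine ⟨?_, ?_, ?_, ?_⟩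
  · have t := key (.iAlls (Fin k) ((Γ.domF p1 x1).imp (.iAlls (Fin k)
      ((Γ.domF (i2 ∘ p1) x2).imp (.iExs (Fin k) (Γ.domF (i3 ∘ i2 ∘ p1) x3 ⊓
        Γ.mulF (i3 ∘ i2 ∘ p1) (i3 ∘ i2 ∘ x1) (i3 ∘ x2) x3))))))
    simp only [FirstOrder.Language.Formula.realize_iAlls, FirstOrder.Language.Formula.realize_iExs,
      FirstOrder.Language.Formula.realize_imp, FirstOrder.Language.Formula.realize_inf,
      realize_domF, realize_mulF] at t
    exact t h.total
  · have t := key (.iAlls (Fin k) ((Γ.domF p1 x1).imp (.iAlls (Fin k)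
      ((Γ.domF (i2 ∘ p1) x2).imp (.iAlls (Fin k) ((Γ.domF (i3 ∘ i2 ∘ p1) x3).imp
        (.iAlls (Fin k) ((Γ.domF (i4 ∘ i3 ∘ i2 ∘ p1) x4).imp
          ((Γ.mulF (i4 ∘ i3 ∘ i2 ∘ p1) (i4 ∘ i3 ∘ i2 ∘ x1) (i4 ∘ i3 ∘ x2) (i4 ∘ x3)).imp
            ((Γ.mulF (i4 ∘ i3 ∘ i2 ∘ p1) (i4 ∘ i3 ∘ i2 ∘ x1) (i4 ∘ i3 ∘ x2) x4).imp
              (FirstOrder.Language.Formula.iInf fun j : Fin k =>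
                FirstOrder.Language.Term.equal (.var (i4 (x3 j))) (.var (x4 j)))))))))))))
    simp only [FirstOrder.Language.Formula.realize_iAlls,
      FirstOrder.Language.Formula.realize_imp, FirstOrder.Language.Formula.realize_iInf,
      FirstOrder.Language.Formula.realize_equal, FirstOrder.Language.Term.realize_var,
      realize_domF, realize_mulF] at t
    intro x hx y hy z hz z' hz' h1 h2
    refine funext (t ?_ x hx y hy z hz z' hz' h1 h2)
    intro x hx y hy z hz z' hz' h1 h2 j
    exact congrFun (h.unique x hx y hy z hz z' hz' h1 h2) j
  · have t := key (.iAlls (Fin k) ((Γ.domF p1 x1).imp (.iAlls (Fin k)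
      ((Γ.domF (i2 ∘ p1) x2).imp (.iAlls (Fin k) ((Γ.domF (i3 ∘ i2 ∘ p1) x3).imp
        (.iAlls (Fin k) ((Γ.domF (i4 ∘ i3 ∘ i2 ∘ p1) x4).imp
          (.iAlls (Fin k) ((Γ.domF (i5 ∘ i4 ∘ i3 ∘ i2 ∘ p1) x5).imp
            (.iAlls (Fin k) ((Γ.domF (i6 ∘ i5 ∘ i4 ∘ i3 ∘ i2 ∘ p1) x6).imp
              ((Γ.mulF (i6 ∘ i5 ∘ i4 ∘ i3 ∘ i2 ∘ p1) (i6 ∘ i5 ∘ i4 ∘ i3 ∘ i2 ∘ x1)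
                  (i6 ∘ i5 ∘ i4 ∘ i3 ∘ x2) (i6 ∘ i5 ∘ x4)).imp
                ((Γ.mulF (i6 ∘ i5 ∘ i4 ∘ i3 ∘ i2 ∘ p1) (i6 ∘ i5 ∘ i4 ∘ i3 ∘ x2)
                    (i6 ∘ i5 ∘ i4 ∘ x3) (i6 ∘ x5)).imp
                  ((Γ.mulF (i6 ∘ i5 ∘ i4 ∘ i3 ∘ i2 ∘ p1) (i6 ∘ i5 ∘ x4)
                      (i6 ∘ i5 ∘ i4 ∘ x3) x6).imp
                    (Γ.mulF (i6 ∘ i5 ∘ i4 ∘ i3 ∘ i2 ∘ p1) (i6 ∘ i5 ∘ i4 ∘ i3 ∘ i2 ∘ x1)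
                      (i6 ∘ x5) x6))))))))))))))))
    simp only [FirstOrder.Language.Formula.realize_iAlls,
      FirstOrder.Language.Formula.realize_imp, realize_domF, realize_mulF] at t
    exact t h.assoc
  · have t := key (.iExs (Fin k) (Γ.domF p1 x1 ⊓ .iAlls (Fin k)
      ((Γ.domF (i2 ∘ p1) x2).imp (Γ.mulF (i2 ∘ p1) (i2 ∘ x1) x2 x2 ⊓
        .iExs (Fin k) (Γ.domF (i3 ∘ i2 ∘ p1) x3 ⊓
          Γ.mulF (i3 ∘ i2 ∘ p1) x3 (i3 ∘ x2) (i3 ∘ i2 ∘ x1))))))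
    simp only [FirstOrder.Language.Formula.realize_iAlls, FirstOrder.Language.Formula.realize_iExs,
      FirstOrder.Language.Formula.realize_imp, FirstOrder.Language.Formula.realize_inf,
      realize_domF, realize_mulF] at t
    exact t h.one_inv

end GroupFormulas

/-- A group definable, with parameters, in the structure `M`: its elements are the `k`-tuples
satisfying the domain formula and its operation is given by the multiplication formula. -/
structure DefinableGroup (L : FirstOrder.Language.{u, v}) (M : Type w) [L.Structure M] (k : ℕ)
    extends GroupFormulas L M k where
  isGroup : toGroupFormulas.IsGroup (id : M → M)

namespace DefinableGroup

variable {L : FirstOrder.Language.{u, v}} {M N : Type w} [L.Structure M] [L.Structure N] {k : ℕ}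
variable (G : DefinableGroup L M k) (f : M ↪ₑ[L] N)

/-- The definable group `G` seen in the elementary extension `f : M ↪ₑ[L] N`: the set of tuples
of `N` satisfying the domain formula. -/
def PointsIn : Type w :=
  {x : Fin k → N // G.Dom f x}

/-- The group `G` itself, i.e. its points in `M`. -/
abbrev Points : Type w :=
  G.PointsIn (FirstOrder.Language.ElementaryEmbedding.refl L M)

theorem isGroup_map : G.toGroupFormulas.IsGroup (f : M → N) :=
  G.isGroup.map f

noncomputable instance : Mul (G.PointsIn f) where
  mul x y := ⟨((G.isGroup_map f).total x.1 x.2 y.1 y.2).choose,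
    ((G.isGroup_map f).total x.1 x.2 y.1 y.2).choose_spec.1⟩

noncomputable instance : One (G.PointsIn f) where
  one := ⟨(G.isGroup_map f).one_inv.choose, (G.isGroup_map f).one_inv.choose_spec.1⟩

noncomputable instance : Inv (G.PointsIn f) where
  inv x := ⟨((G.isGroup_map f).one_inv.choose_spec.2 x.1 x.2).2.choose,
    ((G.isGroup_map f).one_inv.choose_spec.2 x.1 x.2).2.choose_spec.1⟩

variable {G f}

theorem mul_spec (x y : G.PointsIn f) : G.Mul f x.1 y.1 (x * y).1 :=
  ((G.isGroup_map f).total x.1 x.2 y.1 y.2).choose_spec.2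

theorem mul_eq_iff (x y z : G.PointsIn f) : x * y = z ↔ G.Mul f x.1 y.1 z.1 :=
  ⟨fun h => h ▸ mul_spec x y, fun h => Subtype.ext
    ((G.isGroup_map f).unique _ x.2 _ y.2 _ (x * y).2 _ z.2 (mul_spec x y) h)⟩

/-- The group structure on the points of `G` in `N`, in which `x * y = z` holds exactly when the
multiplication formula does. -/
noncomputable instance : Group (G.PointsIn f) :=
  Group.ofLeftAxioms
    (fun x y z => ((mul_eq_iff x (y * z) _).2 ((G.isGroup_map f).assoc _ x.2 _ y.2 _ z.2 _
      (x * y).2 _ (y * z).2 _ (x * y * z).2 (mul_spec x y) (mul_spec y z)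
      (mul_spec (x * y) z))).symm)
    (fun x => (mul_eq_iff 1 x x).2 ((G.isGroup_map f).one_inv.choose_spec.2 x.1 x.2).1)
    (fun x => (mul_eq_iff x⁻¹ x 1).2
      ((G.isGroup_map f).one_inv.choose_spec.2 x.1 x.2).2.choose_spec.2)

theorem dom_comp (c : M → M) (x : Fin k → M) : G.Dom (f ∘ c) (f ∘ x) ↔ G.Dom c x := by
  have := f.map_formula G.dom (Sum.elim c x)
  rwa [Sum.comp_elim] at this

theorem mul_comp (c : M → M) (x y z : Fin k → M) :
    G.Mul (f ∘ c) (f ∘ x) (f ∘ y) (f ∘ z) ↔ G.Mul c x y z := by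
  have := f.map_formula G.mul (Sum.elim c (Sum.elim x (Sum.elim y z)))
  rwa [Sum.comp_elim, Sum.comp_elim, Sum.comp_elim] at this

variable (G f)

/-- The inclusion of `G` into the group it defines in the elementary extension `f : M ↪ₑ[L] N`:
the coordinatewise map `x ↦ f ∘ x`. -/
noncomputable def incl : G.Points →* G.PointsIn f :=
  MonoidHom.mk' (fun x => ⟨f ∘ x.1, (dom_comp (f := f) id x.1).2 x.2⟩) fun x y =>
    ((mul_eq_iff _ _ _).2 ((mul_comp (f := f) id x.1 y.1 (x * y).1).2 (mul_spec x y))).symm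

variable {G f}

/-- A subgroup of the points of `G` in `N` is definable if it is a definable set of tuples of `N`,
with parameters from `N`. -/
def IsDefinable (S : Subgroup (G.PointsIn f)) : Prop :=
  (Set.univ : Set N).Definable L {x : Fin k → N | ∃ g ∈ S, g.1 = x}

end DefinableGroup

/-! ### Almost abelian and almost solvable groups -/

/-- A group is almost abelian if the centralizer of each of its elements has finite index. -/
def IsAlmostAbelian (G : Type*) [Group G] : Prop :=
  ∀ g : G, (Subgroup.centralizer {g}).FiniteIndex

/-- An almost series of length `n` of `G`: normal subgroups `1 = s 0 ≤ s 1 ≤ ⋯ ≤ s n = G` of `G`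
such that all the quotients `s (i + 1) / s i` are almost abelian. -/
structure IsAlmostSeries {G : Type*} [Group G] (n : ℕ) (s : Fin (n + 1) → Subgroup G) : Prop where
  normal : ∀ i, (s i).Normal
  zero : s 0 = ⊥
  last : s (Fin.last n) = ⊤
  le_succ : ∀ i : Fin n, s i.castSucc ≤ s i.succ
  quotient : ∀ i : Fin n,
    haveI := normal i.castSucc
    IsAlmostAbelian (s i.succ ⧸ (s i.castSucc).subgroupOf (s i.succ))

/-- A group is almost solvable if it has an almost series of finite length. -/
def IsAlmostSolvable (G : Type*) [Group G] : Prop :=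
  ∃ (n : ℕ) (s : Fin (n + 1) → Subgroup G), IsAlmostSeries n s

/-- The almost solvable class of an almost solvable group: the least length of an almost series. -/
noncomputable def almostSolvableClass (G : Type*) [Group G] : ℕ :=
  sInf {n : ℕ | ∃ s : Fin (n + 1) → Subgroup G, IsAlmostSeries n s}

/-! The series is built from the bottom. The normal closure of `H` in the large group need not be
definable, so its derived series is replaced by definable conjugation-invariant pieces: level 0
consists of the conjugacy classes of elements of `H`, and level `j + 1` of the conjugates of
commutators between two pieces of level `j`. Their points in `M` lie in the `j`-th derived subgroup
of `H`, so by elementarity the pieces of level `n` are trivial. Start with `s 0 = ⊥`; once a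
definable normal `K = s i` contains level `n - i`, the pieces of level `n - (i + 1)` commute with
each other modulo `K`, and it remains to enclose them in a definable normal `S` that is almost
abelian modulo `K` (`exists_definable_almost_abelian`).

For this, let `Z` be the set of elements centralizing all these pieces modulo `K`, and consider the
cosets of centralizers modulo `K`, uniformly defined by `⁅b⁻¹ * x, d⁆ ∈ K`. Distinct cosets of one
centralizer are disjoint. If elements `d` and `b j` of distinct rows commute modulo `K`, the product
of one `b` from each row lies in all the chosen cosets, so every path is consistent. NTP₂ bounds the
size `n` of such arrays (`exists_bound_of_NTP2`). Hence there is a finite `E ⊆ Z` such that, in the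
common centralizer of the pieces and of the conjugates of `E`, every element has a centralizer
modulo `K` of index less than `n`; otherwise rows could be added one at a time
(`exists_commuting_array`).

This common centralizer is an intersection of possibly infinitely many definable subgroups. The
index bound is uniform, hence first order, so saturation gives it already for a finite
subintersection (`exists_finite_subfamily`), which is definable. That is `S`; it contains the pieces
because they commute with each other and with `E` modulo `K`. -/

open scoped commutatorElement

/-! ### TP₂ from finite arrays, by compactness. -/

namespace FirstOrder.Language.Theory

/-- The formula, in variables for the entries of an array of `q`-tuples, which says that the
instances of `ψ` at two entries of the `i`-th row have no common solution. -/
noncomputable def rowFormula {L : FirstOrder.Language.{u, v}} {p q : ℕ}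
    (ψ : L.Formula (Fin p ⊕ Fin q)) (i j j' : ℕ) : L.Formula (ℕ × ℕ × Fin q) :=
  (Formula.iExs (Fin p)
    (ψ.relabel (Sum.elim Sum.inr fun t => Sum.inl (i, j, t)) ⊓
      ψ.relabel (Sum.elim Sum.inr fun t => Sum.inl (i, j', t)))).not

/-- The formula which says that the instances of `ψ` along the first `n` entries of the path `g`
have a common solution. -/
noncomputable def pathFormula {L : FirstOrder.Language.{u, v}} {p q : ℕ}
    (ψ : L.Formula (Fin p ⊕ Fin q)) (n : ℕ) (g : ℕ → ℕ) : L.Formula (ℕ × ℕ × Fin q) :=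
  Formula.iExs (Fin p) (Formula.iInf fun i : Fin n =>
    ψ.relabel (Sum.elim Sum.inr fun t => Sum.inl ((i : ℕ), g i, t)))

variable {L : FirstOrder.Language.{u, v}} {p q : ℕ} {ψ : L.Formula (Fin p ⊕ Fin q)}

theorem realize_rowFormula {N : Type*} [L.Structure N] (i j j' : ℕ) (e : ℕ × ℕ × Fin q → N) :
    (rowFormula ψ i j j').Realize e ↔
      ¬ ∃ x : Fin p → N, ψ.Realize (Sum.elim x fun t => e (i, j, t)) ∧
        ψ.Realize (Sum.elim x fun t => e (i, j', t)) := by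
  simp only [rowFormula, Formula.realize_not, Formula.realize_iExs, Formula.realize_inf,
    Formula.realize_relabel, Sum.comp_elim, Sum.elim_comp_inr]
  rfl

theorem realize_pathFormula {N : Type*} [L.Structure N] (n : ℕ) (g : ℕ → ℕ)
    (e : ℕ × ℕ × Fin q → N) :
    (pathFormula ψ n g).Realize e ↔
      ∃ x : Fin p → N, ∀ i < n, ψ.Realize (Sum.elim x fun t => e (i, g i, t)) := by
  simp only [pathFormula, Formula.realize_iExs, Formula.realize_iInf,
    Formula.realize_relabel, Sum.comp_elim, Sum.elim_comp_inr, Fin.forall_iff]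
  rfl

/-- By compactness, a theory has TP₂ as soon as one of its models has finite arrays of arbitrary
size with `2`-inconsistent rows and consistent paths. -/
theorem hasTP2_of_finite_arrays {T : L.Theory} {N : Type w} [L.Structure N] [Nonempty N]
    (hN : N ⊨ T) (ψ : L.Formula (Fin p ⊕ Fin q))
    (h : ∀ n : ℕ, ∃ a : ℕ → ℕ → Fin q → N,
      (∀ i < n, ∀ j < n, ∀ j' < n, j ≠ j' →
        ¬ ∃ x : Fin p → N, ψ.Realize (Sum.elim x (a i j)) ∧ ψ.Realize (Sum.elim x (a i j'))) ∧
      ∀ g : ℕ → ℕ, (∀ i < n, g i < n) →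
        ∃ x : Fin p → N, ∀ i < n, ψ.Realize (Sum.elim x (a i (g i)))) : T.HasTP2 := by
  -- Allowing all `m ≤ n` makes these theories increase with `n`; bounding the values of `g` makes
  -- each of them satisfiable by a finite array.
  let Th : ℕ → (L[[ℕ × ℕ × Fin q]]).Theory := fun n =>
    (L.lhomWithConstants (ℕ × ℕ × Fin q)).onTheory T ∪
    ({s | ∃ i < n, ∃ j < n, ∃ j' < n, j ≠ j' ∧ s = Formula.equivSentence (rowFormula ψ i j j')} ∪
    {s | ∃ m ≤ n, ∃ g : ℕ → ℕ, (∀ i < m, g i < m) ∧ s = Formula.equivSentence (pathFormula ψ m g)})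
  have hmono : Monotone Th := by
    intro n n' hn
    refine Set.union_subset_union_right _ (Set.union_subset_union ?_ ?_)
    · rintro s ⟨i, hi, j, hj, j', hj', hs⟩
      exact ⟨i, hi.trans_le hn, j, hj.trans_le hn, j', hj'.trans_le hn, hs⟩
    · rintro s ⟨m, hm, hs⟩
      exact ⟨m, hm.trans hn, hs⟩
  have hsat : IsSatisfiable (⋃ n, Th n) := by
    rw [isSatisfiable_directed_union_iff (directed_of_isDirected_le hmono)]
    intro n
    obtain ⟨a, ha1, ha2⟩ := h n
    let _ : (constantsOn (ℕ × ℕ × Fin q)).Structure N :=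
      constantsOn.structure fun c => a c.1 c.2.1 c.2.2
    have hcon : (fun c : ℕ × ℕ × Fin q => ((L.con c : L[[ℕ × ℕ × Fin q]].Constants) : N)) =
        fun c => a c.1 c.2.1 c.2.2 := rfl
    have : N ⊨ Th n := by
      refine ((LHom.onTheory_model _ _).2 hN).union (Theory.Model.union ?_ ?_)
      · refine ⟨?_⟩
        rintro s ⟨i, hi, j, hj, j', hj', hne, rfl⟩
        rw [Sentence.Realize, ← Sentence.Realize, Formula.realize_equivSentence, hcon,
          realize_rowFormula]
        exact ha1 i hi j hj j' hj' hne
      · refine ⟨?_⟩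
        rintro s ⟨m, hm, g, hg, rfl⟩
        rw [Formula.realize_equivSentence, hcon, realize_pathFormula]
        -- A path of length `m` is prolonged by 0 to one of length `n`.
        obtain ⟨x, hx⟩ := ha2 (fun i => if i < m then g i else 0) (fun i hi => by
          split_ifs with h'
          · exact (hg i h').trans_le hm
          · exact (Nat.zero_le i).trans_lt hi)
        refine ⟨x, fun i hi => ?_⟩
        simpa [hi] using hx i (hi.trans_le hm)
    exact Theory.Model.isSatisfiable N
  obtain ⟨M⟩ := hsat
  let φ := L.lhomWithConstants (ℕ × ℕ × Fin q)
  have hsub : φ.onTheory T ⊆ ⋃ n, Th n := fun s hs => Set.mem_iUnion.2 ⟨0, Or.inl hs⟩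
  let M' : T.ModelType := (M.subtheoryModel hsub).reduct φ
  let _ : L.Structure M := φ.reduct M
  have : φ.IsExpansionOn M := LHom.isExpansionOn_reduct φ M
  let e : ℕ × ℕ × Fin q → M := fun c => ((L.con c : L[[ℕ × ℕ × Fin q]].Constants) : M)
  have hMr : ∀ s ∈ ⋃ n, Th n, M ⊨ s := fun s hs => realize_sentence_of_mem _ hs
  have hrow : ∀ i j j', j ≠ j' → (rowFormula ψ i j j').Realize e := by
    intro i j j' hne
    rw [← Formula.realize_equivSentence]
    refine hMr _ (Set.mem_iUnion.2 ⟨i + j + j' + 1, Or.inr (Or.inl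
      ⟨i, by omega, j, by omega, j', by omega, hne, rfl⟩)⟩)
  have hpath : ∀ m g, (∀ i < m, g i < m) → (pathFormula ψ m g).Realize e := by
    intro m g hg
    rw [← Formula.realize_equivSentence]
    exact hMr _ (Set.mem_iUnion.2 ⟨m, Or.inr (Or.inr ⟨m, le_rfl, g, hg, rfl⟩)⟩)
  simp only [realize_rowFormula] at hrow
  simp only [realize_pathFormula] at hpath
  refine ⟨M', p, q, ψ, fun i j t => e (i, j, t), 2, ?_, ?_⟩
  · intro i s hs
    obtain ⟨j, j', hne, rfl⟩ := Finset.card_eq_two.1 hs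
    rintro ⟨x, hx⟩
    exact hrow i j j' hne ⟨x, hx j (by simp), hx j' (by simp)⟩
  · intro g s
    -- Only square arrays are controlled, so `m` must exceed both the rows in `s` and the values of
    -- `g` there; off `s` the path is reset to 0.
    obtain ⟨m, hm⟩ : ∃ m, ∀ i ∈ s, i < m ∧ g i < m := by
      refine ⟨s.sup (fun i => i + g i) + 1, fun i hi => ?_⟩
      have := Finset.le_sup (f := fun i => i + g i) hi
      omega
    obtain ⟨x, hx⟩ := hpath m (fun i => if i ∈ s then g i else 0) (fun i hi => by
      split_ifs with h'
      · exact (hm i h').2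
      · omega)
    refine ⟨x, fun i hi => ?_⟩
    have := hx i (hm i hi).1
    simp only [hi, if_true] at this
    exact this

end FirstOrder.Language.Theory

/-! ### Calculus of definable relations on points, elementarity and saturation. -/

namespace DefinableGroup

variable {L : FirstOrder.Language.{u, v}} {M N : Type w} [L.Structure M] [L.Structure N] {k : ℕ}
variable {G : DefinableGroup L M k} {f : M ↪ₑ[L] N} {A B : Set N} {ι κ : Type}

/-- The coordinates of a family of points, as a single tuple. -/
def coords (p : ι → G.PointsIn f) : ι × Fin k → N :=
  fun x => (p x.1).1 x.2

theorem coords_injective : Function.Injective (coords : (ι → G.PointsIn f) → ι × Fin k → N) :=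
  fun _ _ h => funext fun i => Subtype.ext (funext fun j => congrFun h (i, j))

theorem mem_image_coords {R : Set (ι → G.PointsIn f)} {p : ι → G.PointsIn f} :
    coords p ∈ coords '' R ↔ p ∈ R :=
  coords_injective.mem_set_image

/-- A relation on the points of `G` in `N` is definable over `A`. -/
def DefinableRel (A : Set N) (R : Set (ι → G.PointsIn f)) : Prop :=
  A.Definable L (coords '' R)

variable (G f) in
/-- The domain of `G` and the graph of its multiplication are definable over `A`. -/
structure DefinableOver (A : Set N) : Prop where
  dom : A.Definable L {x : Fin k → N | G.Dom f x}
  mul : A.Definable L {x : Fin k ⊕ (Fin k ⊕ Fin k) → N |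
    G.Mul f (x ∘ Sum.inl) (x ∘ Sum.inr ∘ Sum.inl) (x ∘ Sum.inr ∘ Sum.inr)}

theorem DefinableOver.mono (h : G.DefinableOver f A) (hAB : A ⊆ B) : G.DefinableOver f B :=
  ⟨h.dom.mono hAB, h.mul.mono hAB⟩

-- The formulas of `G` formally take all of `M` as parameters but mention only finitely many;
-- saturation needs a small parameter set.
variable (G f) in
theorem exists_finite_definableOver :
    ∃ P : Set N, P.Finite ∧ P ⊆ Set.range f ∧ G.DefinableOver f P := by
  have h1 : (Set.range f).Definable L {x : Fin k → N | G.Dom f x} := by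
    rw [Set.definable_iff_exists_formula_sum]
    refine ⟨G.dom.relabel (Sum.map (fun m => ⟨f m, m, rfl⟩) id), Set.ext fun x => ?_⟩
    simp only [Set.mem_ofPred_eq, Language.Formula.realize_relabel, Sum.elim_comp_map]
    rfl
  have h2 : (Set.range f).Definable L {x : Fin k ⊕ (Fin k ⊕ Fin k) → N |
      G.Mul f (x ∘ Sum.inl) (x ∘ Sum.inr ∘ Sum.inl) (x ∘ Sum.inr ∘ Sum.inr)} := by
    rw [Set.definable_iff_exists_formula_sum]
    refine ⟨G.mul.relabel (Sum.map (fun m => ⟨f m, m, rfl⟩) id), Set.ext fun x => ?_⟩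
    simp only [Set.mem_ofPred_eq, Language.Formula.realize_relabel, Sum.elim_comp_map,
      GroupFormulas.Mul]
    congr! 2
    funext i
    rcases i with i | i | i <;> rfl
  rw [Set.definable_iff_finitely_definable] at h1 h2
  obtain ⟨A1, hA1, h1⟩ := h1
  obtain ⟨A2, hA2, h2⟩ := h2
  exact ⟨A1 ∪ A2, A1.finite_toSet.union A2.finite_toSet, Set.union_subset hA1 hA2,
    h1.mono Set.subset_union_left, h2.mono Set.subset_union_right⟩

theorem DefinableRel.mono {R : Set (ι → G.PointsIn f)} (h : DefinableRel A R) (hAB : A ⊆ B) :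
    DefinableRel B R :=
  Set.Definable.mono h hAB

theorem DefinableRel.inter {R S : Set (ι → G.PointsIn f)} (hR : DefinableRel A R)
    (hS : DefinableRel A S) : DefinableRel A (R ∩ S) := by
  rw [DefinableRel, Set.image_inter coords_injective]
  exact Set.Definable.inter hR hS

theorem range_coords : Set.range (coords : (ι → G.PointsIn f) → ι × Fin k → N) =
    ⋂ i, {v | G.Dom f (v ∘ Prod.mk i)} := by
  ext v
  simp only [Set.mem_range, Set.mem_iInter, Set.mem_ofPred_eq]
  constructor
  · rintro ⟨p, rfl⟩ i
    exact (p i).2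
  · exact fun h => ⟨fun i => ⟨v ∘ Prod.mk i, h i⟩, rfl⟩

theorem DefinableOver.range_coords [Finite ι] (hA : G.DefinableOver f A) :
    A.Definable L (Set.range (coords : (ι → G.PointsIn f) → ι × Fin k → N)) := by
  rw [DefinableGroup.range_coords]
  exact Set.definable_iInter_of_finite fun i => hA.dom.preimage_comp (Prod.mk i)

theorem DefinableRel.compl [Finite ι] (hA : G.DefinableOver f A) {R : Set (ι → G.PointsIn f)}
    (hR : DefinableRel A R) : DefinableRel A Rᶜ := by
  rw [DefinableRel, Set.compl_eq_univ_sdiff, Set.image_sdiff coords_injective, Set.image_univ]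
  exact hA.range_coords.sdiff hR

/-- A relation on points whose coordinates satisfy a definable condition is definable. -/
theorem DefinableRel.of_coords [Finite ι] (hA : G.DefinableOver f A) {R : Set (ι → G.PointsIn f)}
    {s : Set (ι × Fin k → N)} (hs : A.Definable L s) (h : ∀ p, p ∈ R ↔ coords p ∈ s) :
    DefinableRel A R := by
  have : coords '' R = Set.range (coords : (ι → G.PointsIn f) → ι × Fin k → N) ∩ s := by
    ext v
    constructor
    · rintro ⟨p, hp, rfl⟩
      exact ⟨⟨p, rfl⟩, (h p).1 hp⟩
    · rintro ⟨⟨p, rfl⟩, hp⟩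
      exact ⟨p, (h p).2 hp, rfl⟩
  rw [DefinableRel, this]
  exact hA.range_coords.inter hs

theorem DefinableRel.preimage [Finite κ] (hA : G.DefinableOver f A) (σ : ι → κ)
    {R : Set (ι → G.PointsIn f)} (hR : DefinableRel A R) :
    DefinableRel A {p : κ → G.PointsIn f | p ∘ σ ∈ R} :=
  .of_coords hA (Set.Definable.preimage_comp (Prod.map σ id) hR) fun p =>
    (mem_image_coords (p := p ∘ σ)).symm

theorem DefinableRel.exists [Finite ι] [Finite κ] {R : Set (ι ⊕ κ → G.PointsIn f)}
    (hR : DefinableRel A R) :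
    DefinableRel A {p : ι → G.PointsIn f | ∃ q : κ → G.PointsIn f, Sum.elim p q ∈ R} := by
  have h := Set.Definable.image_comp hR (Prod.map (Sum.inl : ι → ι ⊕ κ) (id : Fin k → Fin k))
  rw [Set.image_image] at h
  rw [DefinableRel]
  convert! h using 1
  ext v
  constructor
  · rintro ⟨p, ⟨q, hq⟩, rfl⟩
    exact ⟨_, hq, rfl⟩
  · rintro ⟨r, hr, rfl⟩
    exact ⟨r ∘ Sum.inl, ⟨r ∘ Sum.inr, by rwa [Sum.elim_comp_inl_inr]⟩, rfl⟩

theorem DefinableRel.iInter [Finite ι] {κ : Type*} [Finite κ] (hA : G.DefinableOver f A)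
    {R : κ → Set (ι → G.PointsIn f)} (hR : ∀ i, DefinableRel A (R i)) :
    DefinableRel A (⋂ i, R i) :=
  .of_coords hA (Set.definable_iInter_of_finite hR) fun p => by
    simp only [Set.mem_iInter, mem_image_coords]

/-- A function on tuples of points is definable over `A` if its graph is. -/
def DefinableTerm (A : Set N) (t : (ι → G.PointsIn f) → G.PointsIn f) : Prop :=
  DefinableRel A {p : ι ⊕ Unit → G.PointsIn f | p (.inr ()) = t (p ∘ .inl)}

theorem DefinableTerm.precomp [Finite κ] (hA : G.DefinableOver f A) (σ : ι → κ)
    {t : (ι → G.PointsIn f) → G.PointsIn f} (ht : DefinableTerm A t) :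
    DefinableTerm A fun p : κ → G.PointsIn f => t (p ∘ σ) :=
  DefinableRel.preimage hA (Sum.map σ (id : Unit → Unit)) ht

/-- Name the values of the terms by new variables, constrain these by the graphs, and project them
away. -/
theorem DefinableRel.subst [Finite ι] [Finite κ] (hA : G.DefinableOver f A)
    {R : Set (κ → G.PointsIn f)} (hR : DefinableRel A R)
    {t : κ → (ι → G.PointsIn f) → G.PointsIn f} (ht : ∀ i, DefinableTerm A (t i)) :
    DefinableRel A {p : ι → G.PointsIn f | (fun i => t i p) ∈ R} := by
  have h1 : DefinableRel A {r : ι ⊕ κ → G.PointsIn f | r ∘ Sum.inr ∈ R} := hR.preimage hA Sum.inr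
  have h2 : ∀ i, DefinableRel A {r : ι ⊕ κ → G.PointsIn f | r (.inr i) = t i (r ∘ Sum.inl)} :=
    fun i => DefinableRel.preimage hA (Sum.map id fun _ : Unit => i) (ht i)
  convert! (h1.inter (DefinableRel.iInter hA h2)).exists using 1
  ext p
  simp only [Set.mem_ofPred_eq, Set.mem_inter_iff, Set.mem_iInter, Sum.elim_comp_inr,
    Sum.elim_comp_inl, Sum.elim_inr]
  constructor
  · exact fun h => ⟨_, h, fun i => rfl⟩
  · rintro ⟨q, hq, hqt⟩
    rwa [← funext hqt]

/-- A set of points is definable over `A`. -/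
def DefinableSet (A : Set N) (Q : Set (G.PointsIn f)) : Prop :=
  DefinableRel A {p : Unit → G.PointsIn f | p () ∈ Q}

theorem DefinableSet.mono {Q : Set (G.PointsIn f)} (h : DefinableSet A Q) (hAB : A ⊆ B) :
    DefinableSet B Q :=
  DefinableRel.mono h hAB

theorem DefinableSet.mem [Finite ι] (hA : G.DefinableOver f A) {Q : Set (G.PointsIn f)}
    (hQ : DefinableSet A Q) {t : (ι → G.PointsIn f) → G.PointsIn f} (ht : DefinableTerm A t) :
    DefinableRel A {p | t p ∈ Q} :=
  DefinableRel.subst hA hQ (t := fun _ => t) fun _ => ht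

theorem definableRel_eq (hA : G.DefinableOver f A) :
    DefinableRel A {p : Fin 2 → G.PointsIn f | p 0 = p 1} := by
  refine .of_coords hA (s := ⋂ j : Fin k, {v | v (0, j) = v (1, j)})
    (Set.definable_iInter_of_finite fun j =>
      Set.DefinableFun.ofPred_eq (Set.DefinableFun.proj L) (Set.DefinableFun.proj L)) fun p => ?_
  simp only [Set.mem_ofPred_eq, Set.mem_iInter]
  exact Subtype.ext_iff.trans funext_iff

theorem definableTerm_proj [Finite ι] (hA : G.DefinableOver f A) (i : ι) :
    DefinableTerm A fun p : ι → G.PointsIn f => p i :=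
  (definableRel_eq hA).preimage hA ![Sum.inr (), Sum.inl i]

theorem DefinableTerm.eq [Finite ι] (hA : G.DefinableOver f A)
    {t s : (ι → G.PointsIn f) → G.PointsIn f} (ht : DefinableTerm A t) (hs : DefinableTerm A s) :
    DefinableRel A {p | t p = s p} :=
  (definableRel_eq hA).subst hA (t := ![t, s]) (Fin.forall_fin_two.2 ⟨ht, hs⟩)

theorem definableRel_mul (hA : G.DefinableOver f A) :
    DefinableRel A {p : Fin 3 → G.PointsIn f | p 0 * p 1 = p 2} := by
  refine .of_coords hA (hA.mul.preimage_comp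
    (Sum.elim (Prod.mk 0) (Sum.elim (Prod.mk 1) (Prod.mk 2)))) fun p => ?_
  exact mul_eq_iff _ _ _

theorem DefinableTerm.mul_eq [Finite ι] (hA : G.DefinableOver f A)
    {t s r : (ι → G.PointsIn f) → G.PointsIn f} (ht : DefinableTerm A t) (hs : DefinableTerm A s)
    (hr : DefinableTerm A r) : DefinableRel A {p | t p * s p = r p} := by
  refine (definableRel_mul hA).subst hA (t := ![t, s, r]) fun i => ?_
  fin_cases i
  exacts [ht, hs, hr]

theorem DefinableTerm.mul [Finite ι] (hA : G.DefinableOver f A)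
    {t s : (ι → G.PointsIn f) → G.PointsIn f} (ht : DefinableTerm A t) (hs : DefinableTerm A s) :
    DefinableTerm A fun p => t p * s p := by
  have h := mul_eq hA (ht.precomp hA (Sum.inl : ι → ι ⊕ Unit))
    (hs.precomp hA (Sum.inl : ι → ι ⊕ Unit)) (definableTerm_proj hA (Sum.inr ()))
  simpa only [DefinableTerm, eq_comm] using h

theorem definableTerm_one [Finite ι] (hA : G.DefinableOver f A) :
    DefinableTerm A fun _ : ι → G.PointsIn f => 1 := by
  have h := DefinableTerm.mul_eq (ι := ι ⊕ Unit) hA (definableTerm_proj hA (Sum.inr ()))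
    (definableTerm_proj hA (Sum.inr ())) (definableTerm_proj hA (Sum.inr ()))
  simpa only [DefinableTerm, mul_eq_left] using h

theorem DefinableTerm.inv [Finite ι] (hA : G.DefinableOver f A)
    {t : (ι → G.PointsIn f) → G.PointsIn f} (ht : DefinableTerm A t) :
    DefinableTerm A fun p => (t p)⁻¹ := by
  have h := mul_eq hA (definableTerm_proj hA (Sum.inr ()))
    (ht.precomp hA (Sum.inl : ι → ι ⊕ Unit)) (definableTerm_one hA)
  simpa only [DefinableTerm, mul_eq_one_iff_eq_inv] using h

theorem definableTerm_const [Finite ι] (hA : G.DefinableOver f A) {g : G.PointsIn f}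
    (hg : Set.range g.1 ⊆ A) : DefinableTerm A fun _ : ι → G.PointsIn f => g := by
  refine DefinableRel.of_coords hA (s := ⋂ j : Fin k, {v | v (Sum.inr (), j) = g.1 j})
    (Set.definable_iInter_of_finite fun j =>
      Set.DefinableFun.ofPred_eq_const (Set.DefinableFun.proj L) (hg ⟨j, rfl⟩)) fun p => ?_
  simp only [Set.mem_ofPred_eq, Set.mem_iInter]
  exact Subtype.ext_iff.trans funext_iff

theorem DefinableTerm.commutator [Finite ι] (hA : G.DefinableOver f A)
    {t s : (ι → G.PointsIn f) → G.PointsIn f} (ht : DefinableTerm A t) (hs : DefinableTerm A s) :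
    DefinableTerm A fun p => ⁅t p, s p⁆ :=
  ((ht.mul hA hs).mul hA (ht.inv hA)).mul hA (hs.inv hA)

theorem DefinableTerm.conj [Finite ι] (hA : G.DefinableOver f A)
    {t s : (ι → G.PointsIn f) → G.PointsIn f} (ht : DefinableTerm A t) (hs : DefinableTerm A s) :
    DefinableTerm A fun p => t p * s p * (t p)⁻¹ :=
  (ht.mul hA hs).mul hA (ht.inv hA)

theorem IsDefinable.of_definableSet {S : Subgroup (G.PointsIn f)}
    (hS : DefinableSet A (S : Set (G.PointsIn f))) : IsDefinable S := by
  have h := (Set.Definable.mono hS (Set.subset_univ A)).preimage_comp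
    (Prod.snd : Unit × Fin k → Fin k)
  rw [IsDefinable]
  convert! h using 1
  ext x
  constructor
  · rintro ⟨g, hg, rfl⟩
    exact ⟨fun _ => g, hg, rfl⟩
  · rintro ⟨p, hp, h⟩
    exact ⟨p (), hp, funext fun j => congrFun h ((), j)⟩

/-- A nonempty relation definable over the image of `M` holds of some points of `G` in `M`. -/
theorem DefinableRel.exists_incl [Finite ι] {R : Set (ι → G.PointsIn f)}
    (hR : DefinableRel (Set.range f) R) (hne : R.Nonempty) :
    ∃ p : ι → G.Points, (fun i => G.incl f (p i)) ∈ R := by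
  obtain ⟨φ, hφ⟩ := Set.definable_iff_exists_formula_sum.1 hR
  choose m hm using fun a : Set.range f => a.2
  have hφf : ∀ v : ι × Fin k → M,
      φ.Realize (Sum.elim (fun a : Set.range f => (a : N)) (f ∘ v)) ↔
        φ.Realize (Sum.elim m v) := by
    intro v
    rw [← f.map_formula, Sum.comp_elim]
    congr! 2
    exact funext fun a => (hm a).symm
  -- The parameters are pulled back to `M`, where solvability of `φ` holds by elementarity.
  have hex : (Language.Formula.iExs (ι × Fin k) φ).Realize m := by
    rw [← f.map_formula, Language.Formula.realize_iExs]
    obtain ⟨r, hr⟩ := hne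
    refine ⟨coords r, ?_⟩
    have : coords r ∈ coords '' R := ⟨r, hr, rfl⟩
    rw [hφ] at this
    rwa [show f ∘ m = Subtype.val from funext hm]
  obtain ⟨v, hv⟩ := Language.Formula.realize_iExs.1 hex
  have hv' : f ∘ v ∈ coords '' R := by
    rw [hφ]
    exact (hφf v).2 hv
  obtain ⟨r, hr, hrv⟩ := hv'
  have hdom : ∀ i, G.Dom id (v ∘ Prod.mk i) := fun i => by
    rw [← dom_comp (f := f), ← Function.comp_assoc, ← hrv]
    exact (r i).2
  refine ⟨fun i => ⟨v ∘ Prod.mk i, hdom i⟩, ?_⟩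
  convert! hr using 1
  refine coords_injective (hrv.trans ?_).symm
  rfl

/-- A definable relation between a point and a tuple of points is given by a formula without
parameters, the tuple and the parameters being coded by a single tuple of elements. -/
theorem DefinableRel.exists_formula [Finite κ] {R : Set (Unit ⊕ κ → G.PointsIn f)}
    (hR : DefinableRel A R) :
    ∃ (q : ℕ) (ψ : L.Formula (Fin k ⊕ Fin q)) (c : (κ → G.PointsIn f) → Fin q → N),
      ∀ (x : Fin k → N) (y : κ → G.PointsIn f), ψ.Realize (Sum.elim x (c y)) ↔
        ∃ g : G.PointsIn f, g.1 = x ∧ Sum.elim (fun _ => g) y ∈ R := by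
  obtain ⟨A₀, -, hR⟩ := Set.definable_iff_finitely_definable.1 hR
  obtain ⟨φ, hφ⟩ := Set.definable_iff_exists_formula_sum.1 hR
  -- The `q` parameter slots hold the finitely many parameters used, followed by the coordinates of
  -- the tuple `y`.
  obtain ⟨q, ⟨e⟩⟩ := Finite.exists_equiv_fin ((A₀ : Set N) ⊕ κ × Fin k)
  refine ⟨q, φ.relabel (Sum.elim (fun a => Sum.inr (e (Sum.inl a)))
    fun z => Sum.elim (fun _ => Sum.inl z.2) (fun i => Sum.inr (e (Sum.inr (i, z.2)))) z.1),
    fun y => Sum.elim (↑) (coords y) ∘ e.symm, fun x y => ?_⟩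
  have key : φ.Realize (Sum.elim (fun a : (A₀ : Set N) => (a : N))
      fun z => Sum.elim (fun _ : Unit => x z.2) (fun i => (y i).1 z.2) z.1) ↔
        ∃ g : G.PointsIn f, g.1 = x ∧ Sum.elim (fun _ => g) y ∈ R := by
    have : φ.Realize (Sum.elim (fun a : (A₀ : Set N) => (a : N))
      fun z => Sum.elim (fun _ : Unit => x z.2) (fun i => (y i).1 z.2) z.1) ↔
        (fun z : (Unit ⊕ κ) × Fin k => Sum.elim (fun _ : Unit => x z.2)
          (fun i => (y i).1 z.2) z.1) ∈ coords '' R := by rw [hφ]; rfl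
    rw [this]
    constructor
    · rintro ⟨r, hr, h⟩
      refine ⟨r (.inl ()), funext fun j => congrFun h (.inl (), j), ?_⟩
      convert! hr using 1
      funext i
      rcases i with i | i
      · rfl
      · exact Subtype.ext (funext fun j => (congrFun h (.inr i, j)).symm)
    · rintro ⟨g, rfl, hg⟩
      refine ⟨_, hg, ?_⟩
      funext ⟨i, j⟩
      rcases i with i | i <;> rfl
  rw [Language.Formula.realize_relabel, ← key]
  congr! 2
  funext i
  rcases i with a | ⟨i | i, j⟩ <;> simp [coords]

/-- In a saturated structure, a family of relations definable over a small set of parameters which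
has the finite intersection property has a common point. -/
theorem exists_mem_of_isSaturated [Finite ι] {c : Cardinal.{w}} (hN : L.IsSaturated N c)
    (hAc : Cardinal.mk A < c) {𝒮 : Set (Set (ι → G.PointsIn f))}
    (h𝒮 : ∀ R ∈ 𝒮, DefinableRel A R) (hne : 𝒮.Nonempty)
    (hfin : ∀ 𝒯 ⊆ 𝒮, 𝒯.Finite → ∃ p, ∀ R ∈ 𝒯, p ∈ R) : ∃ p, ∀ R ∈ 𝒮, p ∈ R := by
  obtain ⟨m, ⟨e⟩⟩ := Finite.exists_equiv_fin (ι × Fin k)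
  have hdef : ∀ R ∈ 𝒮, ∃ φ : L[[A]].Formula (Fin m),
      ∀ x : Fin m → N, φ.Realize x ↔ x ∘ e ∈ coords '' R := by
    intro R hR
    obtain ⟨φ, hφ⟩ := h𝒮 R hR
    refine ⟨φ.relabel e, fun x => ?_⟩
    rw [Language.Formula.realize_relabel, hφ]
    rfl
  choose! φ hφ using hdef
  obtain ⟨x, hx⟩ := hN A hAc m (φ '' 𝒮) (by
    intro s hs
    obtain ⟨𝒯, h𝒯, h𝒯fin, h𝒯s⟩ := Set.exists_subset_image_finite_and.1
      ⟨(s : Set (L[[A]].Formula (Fin m))), hs, s.finite_toSet, rfl⟩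
    obtain ⟨p, hp⟩ := hfin 𝒯 h𝒯 h𝒯fin
    refine ⟨coords p ∘ e.symm, fun ψ hψ => ?_⟩
    obtain ⟨R, hR, rfl⟩ : ψ ∈ φ '' 𝒯 := h𝒯s ▸ hψ
    rw [hφ R (h𝒯 hR)]
    refine ⟨p, hp R hR, ?_⟩
    funext z
    simp)
  -- Some member of the family is needed to know that the realized tuple of elements of `N` consists
  -- of points of `G`.
  obtain ⟨R₀, hR₀⟩ := hne
  obtain ⟨p, -, hp⟩ := (hφ R₀ hR₀ x).1 (hx _ ⟨R₀, hR₀, rfl⟩)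
  refine ⟨p, fun R hR => ?_⟩
  have := (hφ R hR x).1 (hx _ ⟨R, hR, rfl⟩)
  rwa [← hp, mem_image_coords] at this

end DefinableGroup

/-! ### Group theory of centralizers and commuting arrays. -/

/-- If among any `n` elements of a group two are congruent modulo the centralizer of `g`, this
centralizer has finite index. -/
theorem Subgroup.finiteIndex_centralizer_of_forall_commute {Q : Type*} [Group Q] (g : Q) (n : ℕ)
    (h : ∀ b : Fin n → Q, ∃ i j, i ≠ j ∧ Commute ((b i)⁻¹ * b j) g) :
    (Subgroup.centralizer {g}).FiniteIndex := by
  rw [Subgroup.finiteIndex_iff_finite_quotient]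
  by_contra hinf
  rw [not_finite_iff_infinite] at hinf
  let e : Fin n ↪ Q ⧸ Subgroup.centralizer {g} :=
    Fin.valEmbedding.trans (Infinite.natEmbedding _)
  obtain ⟨i, j, hij, hc⟩ := h fun i => (e i).out
  refine hij (e.injective ?_)
  rw [← QuotientGroup.out_eq' (e i), ← QuotientGroup.out_eq' (e j), QuotientGroup.eq,
    Subgroup.mem_centralizer_singleton_iff]
  exact hc.eq

/-- Bridge between the definable condition, stated in the group, and the computations, made in the
quotient. -/
theorem Subgroup.commutatorElement_mem_iff_commute {Q : Type*} [Group Q] (K : Subgroup Q)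
    [K.Normal] (a b : Q) : ⁅a, b⁆ ∈ K ↔ Commute (a : Q ⧸ K) (b : Q ⧸ K) := by
  rw [← QuotientGroup.eq_one_iff, ← commutatorElement_eq_one_iff_commute]
  rfl

/-- If in `Z` one can find, commuting modulo the kernel of `π` with any given finite subset, an
element `d` and `n` elements pairwise incongruent modulo its centralizer, then there are arrays of
such data in which the members of distinct rows commute. -/
theorem exists_commuting_array {X Y : Type*} [Group X] [Group Y] (π : X →* Y) (Z : Set X) (n : ℕ)
    (h : ∀ E ⊆ Z, E.Finite → ∃ d ∈ Z, ∃ b : Fin n → X, (∀ j, b j ∈ Z) ∧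
      (∀ e ∈ E, Commute (π d) (π e) ∧ ∀ j, Commute (π (b j)) (π e)) ∧
      ∀ j j', j ≠ j' → ¬ Commute (π ((b j)⁻¹ * b j')) (π d)) (m : ℕ) :
    ∃ (d : ℕ → X) (b : ℕ → Fin n → X), (∀ i < m, d i ∈ Z ∧ ∀ j, b i j ∈ Z) ∧
      (∀ i < m, ∀ i' < m, i ≠ i' → ∀ j,
        Commute (π (b i j)) (π (d i')) ∧ ∀ j', Commute (π (b i j)) (π (b i' j'))) ∧
      ∀ i < m, ∀ j j', j ≠ j' → ¬ Commute (π ((b i j)⁻¹ * b i j')) (π (d i)) := by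
  induction m with
  | zero => exact ⟨fun _ => 1, fun _ _ => 1, by simp⟩
  | succ m ih =>
    obtain ⟨d, b, hZ, hcomm, hrow⟩ := ih
    -- All entries of the rows built so far: the new row has to commute with them.
    let E : Set X := ⋃ i : Fin m, insert (d i) (Set.range (b i))
    have hd : ∀ i < m, d i ∈ E := fun i hi => Set.mem_iUnion.2 ⟨⟨i, hi⟩, Set.mem_insert _ _⟩
    have hb : ∀ i < m, ∀ j, b i j ∈ E :=
      fun i hi j => Set.mem_iUnion.2 ⟨⟨i, hi⟩, Set.mem_insert_of_mem _ ⟨j, rfl⟩⟩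
    obtain ⟨d', hd', b', hb', hE, hrow'⟩ := h E
      (Set.iUnion_subset fun i => Set.insert_subset (hZ i i.2).1
        (Set.range_subset_iff.2 (hZ i i.2).2))
      (Set.finite_iUnion fun i => (Set.finite_range _).insert _)
    refine ⟨Function.update d m d', Function.update b m b', ?_, ?_, ?_⟩
    · intro i hi
      rcases (Nat.lt_succ_iff_lt_or_eq.1 hi) with hi | rfl
      · simpa [hi.ne] using hZ i hi
      · simpa using ⟨hd', hb'⟩
    · intro i hi i' hi' hne j
      rcases (Nat.lt_succ_iff_lt_or_eq.1 hi) with hi | rfl <;>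
        rcases (Nat.lt_succ_iff_lt_or_eq.1 hi') with hi' | rfl
      · simpa [hi.ne, hi'.ne] using hcomm i hi i' hi' hne j
      · simpa [hi.ne] using
          ⟨(hE _ (hb i hi j)).1.symm, fun j' => ((hE _ (hb i hi j)).2 j').symm⟩
      · simpa [hi'.ne] using
          ⟨(hE _ (hd i' hi')).2 j, fun j' => (hE _ (hb i' hi' j')).2 j⟩
      · exact absurd rfl hne
    · intro i hi
      rcases (Nat.lt_succ_iff_lt_or_eq.1 hi) with hi | rfl
      · simpa [hi.ne] using hrow i hi
      · simpa using hrow'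

/-- A product of pairwise commuting elements is congruent to each of them modulo the centralizer
of any element which commutes with all the others. -/
theorem exists_commute_inv_mul {Y : Type*} [Group Y] (m : ℕ) (b d : ℕ → Y)
    (hb : ∀ i < m, ∀ i' < m, i ≠ i' → Commute (b i) (b i') ∧ Commute (b i) (d i')) :
    ∃ x : Y, ∀ i < m, Commute ((b i)⁻¹ * x) (d i) := by
  have hpw : (Finset.range m : Set ℕ).Pairwise (Function.onFun Commute b) := by
    intro i hi i' hi' hne
    exact (hb i (by simpa using hi) i' (by simpa using hi') hne).1
  refine ⟨(Finset.range m).noncommProd b hpw, fun i hi => ?_⟩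
  rw [← Finset.mul_noncommProd_erase _ (Finset.mem_range.2 hi), inv_mul_cancel_left]
  refine (Finset.noncommProd_commute _ _ _ _ fun i' hi' => ?_).symm
  rw [Finset.mem_erase, Finset.mem_range] at hi'
  exact (hb i' hi'.2 i hi hi'.1).2.symm

/-! ### The bound given by NTP₂. -/

namespace DefinableGroup

variable {L : FirstOrder.Language.{u, v}} {M N : Type w} [L.Structure M] [L.Structure N] {k : ℕ}
variable {G : DefinableGroup L M k} {f : M ↪ₑ[L] N} {A : Set N}

/-- In an NTP₂ theory the arrays of centralizers modulo a definable normal subgroup, with pairwise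
disjoint cosets in each row and consistent paths, have bounded size. -/
theorem exists_bound_of_NTP2 {T : L.Theory} (hT : T.NTP2) [Nonempty N] (hN : N ⊨ T)
    (hA : G.DefinableOver f A) (K : Subgroup (G.PointsIn f)) [K.Normal]
    (hK : DefinableSet A (K : Set (G.PointsIn f))) :
    ∃ n : ℕ, ∀ (d : ℕ → G.PointsIn f) (b : ℕ → ℕ → G.PointsIn f),
      (∀ i < n, ∀ j < n, ∀ j' < n, j ≠ j' → ⁅(b i j)⁻¹ * b i j', d i⁆ ∉ K) →
      ¬ ∀ g : ℕ → ℕ, (∀ i < n, g i < n) → ∃ x, ∀ i < n, ⁅(b i (g i))⁻¹ * x, d i⁆ ∈ K := by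
  by_contra! hcon
  have hR : DefinableRel A {p : Unit ⊕ Fin 2 → G.PointsIn f |
      ⁅(p (.inr 0))⁻¹ * p (.inl ()), p (.inr 1)⁆ ∈ (K : Set (G.PointsIn f))} :=
    hK.mem hA ((((definableTerm_proj hA _).inv hA).mul hA (definableTerm_proj hA _)).commutator hA
      (definableTerm_proj hA _))
  -- `ψ` says that `x` lies in the coset of `b` modulo the centralizer of `d` modulo `K`.
  obtain ⟨q, ψ, c, hψ⟩ := hR.exists_formula
  have hψ' : ∀ (x : Fin k → N) (b d : G.PointsIn f), ψ.Realize (Sum.elim x (c ![b, d])) ↔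
      ∃ g : G.PointsIn f, g.1 = x ∧ ⁅b⁻¹ * g, d⁆ ∈ K := fun x b d => hψ x ![b, d]
  refine hT (Language.Theory.hasTP2_of_finite_arrays hN ψ fun n => ?_)
  obtain ⟨d, b, hrow, hpath⟩ := hcon n
  refine ⟨fun i j => c ![b i j, d i], ?_, ?_⟩
  · intro i hi j hj j' hj' hne
    rintro ⟨x, h1, h2⟩
    obtain ⟨g, rfl, hg⟩ := (hψ' _ _ _).1 h1
    obtain ⟨g', hgg', hg'⟩ := (hψ' _ _ _).1 h2
    obtain rfl : g' = g := Subtype.ext hgg'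
    refine hrow i hi j hj j' hj' hne ?_
    rw [Subgroup.commutatorElement_mem_iff_commute] at hg hg' ⊢
    -- A common point `g` of two cosets makes them equal: `(b⁻¹ * g) * (b'⁻¹ * g)⁻¹ = b⁻¹ * b'`.
    have := hg.mul_left hg'.inv_left
    rwa [← QuotientGroup.mk_inv, ← QuotientGroup.mk_mul, mul_inv_rev, inv_inv, mul_assoc,
      mul_inv_cancel_left] at this
  · intro g hg
    obtain ⟨x, hx⟩ := hpath g hg
    exact ⟨x.1, fun i hi => (hψ' _ _ _).2 ⟨x, rfl, hx i hi⟩⟩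

end DefinableGroup

/-! ### Centralizers modulo a normal subgroup, and their definability. -/

/-- The elements which commute modulo `K` with all the elements of `Q`. -/
def Subgroup.centralizerMod {X : Type*} [Group X] (K : Subgroup X) [K.Normal] (Q : Set X) :
    Subgroup X :=
  (Subgroup.centralizer (QuotientGroup.mk' K '' Q)).comap (QuotientGroup.mk' K)

theorem Subgroup.mem_centralizerMod {X : Type*} [Group X] {K : Subgroup X} [K.Normal] {Q : Set X}
    {x : X} : x ∈ K.centralizerMod Q ↔ ∀ y ∈ Q, ⁅x, y⁆ ∈ K := by
  simp only [Subgroup.centralizerMod, Subgroup.mem_comap, Subgroup.mem_centralizer_iff,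
    Set.forall_mem_image, Subgroup.commutatorElement_mem_iff_commute]
  exact forall₂_congr fun y _ => eq_comm

theorem Subgroup.le_centralizerMod {X : Type*} [Group X] (K : Subgroup X) [K.Normal] (Q : Set X) :
    K ≤ K.centralizerMod Q := by
  intro x hx
  rw [mem_centralizerMod]
  intro y _
  rw [commutatorElement_mem_iff_commute, (QuotientGroup.eq_one_iff x).2 hx]
  exact Commute.one_left _

theorem Subgroup.normal_centralizerMod {X : Type*} [Group X] (K : Subgroup X) [K.Normal]
    {Q : Set X} (hQ : ∀ x ∈ Q, ∀ g : X, g * x * g⁻¹ ∈ Q) : (K.centralizerMod Q).Normal := by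
  refine ⟨fun x hx g => ?_⟩
  rw [mem_centralizerMod] at hx ⊢
  intro y hy
  -- Test `x` against `g⁻¹ * y * g`, again in `Q`, and conjugate the commutator by `g`.
  have h := ‹K.Normal›.conj_mem _ (hx _ (by simpa using hQ y hy g⁻¹)) g
  rw [conjugate_commutatorElement] at h
  simpa only [mul_assoc, mul_inv_cancel_left, mul_inv_cancel, mul_one] using h

namespace DefinableGroup

variable {L : FirstOrder.Language.{u, v}} {M N : Type w} [L.Structure M] [L.Structure N] {k : ℕ}
variable {G : DefinableGroup L M k} {f : M ↪ₑ[L] N} {A : Set N}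

theorem DefinableSet.centralizerMod (hA : G.DefinableOver f A) (K : Subgroup (G.PointsIn f))
    [K.Normal] (hK : DefinableSet A (K : Set (G.PointsIn f))) {Q : Set (G.PointsIn f)}
    (hQ : DefinableSet A Q) :
    DefinableSet A (K.centralizerMod Q : Set (G.PointsIn f)) := by
  have h1 : DefinableRel A {p : Unit ⊕ Unit → G.PointsIn f | p (.inr ()) ∈ Q} :=
    hQ.mem hA (definableTerm_proj hA _)
  have h2 : DefinableRel A {p : Unit ⊕ Unit → G.PointsIn f |
      ⁅p (.inl ()), p (.inr ())⁆ ∈ (K : Set (G.PointsIn f))} :=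
    hK.mem hA ((definableTerm_proj hA _).commutator hA (definableTerm_proj hA _))
  rw [DefinableSet]
  convert! (h1.inter (h2.compl hA)).exists.compl hA using 1
  ext p
  simp only [SetLike.mem_coe, Subgroup.mem_centralizerMod, Set.mem_ofPred_eq, Set.mem_compl_iff,
    Set.mem_inter_iff, Sum.elim_inr, Sum.elim_inl, not_exists, not_and, not_not]
  exact ⟨fun h q => h (q ()), fun h y => h fun _ => y⟩

theorem definableSet_conjugates (hA : G.DefinableOver f A) {e : G.PointsIn f}
    (he : Set.range e.1 ⊆ A) : DefinableSet A {x | ∃ g, x = g * e * g⁻¹} := by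
  have h : DefinableRel A {p : Unit ⊕ Unit → G.PointsIn f |
      p (.inl ()) = p (.inr ()) * e * (p (.inr ()))⁻¹} :=
    (definableTerm_proj hA _).eq hA ((definableTerm_proj hA _).conj hA (definableTerm_const hA he))
  rw [DefinableSet]
  convert! h.exists using 1
  ext p
  exact ⟨fun ⟨g, hg⟩ => ⟨fun _ => g, hg⟩, fun ⟨g, hg⟩ => ⟨g (), hg⟩⟩

theorem DefinableSet.biInter (hA : G.DefinableOver f A) {𝒬 : Set (Set (G.PointsIn f))}
    (h𝒬 : 𝒬.Finite) {F : Set (G.PointsIn f) → Subgroup (G.PointsIn f)}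
    (hF : ∀ Q ∈ 𝒬, DefinableSet A (F Q : Set (G.PointsIn f))) :
    DefinableSet A ((⨅ Q ∈ 𝒬, F Q : Subgroup (G.PointsIn f)) : Set (G.PointsIn f)) := by
  have : Finite 𝒬 := h𝒬
  have h := DefinableRel.iInter hA (R := fun Q : 𝒬 => {p : Unit → G.PointsIn f | p () ∈ F Q})
    fun Q => hF Q Q.2
  rw [DefinableSet]
  convert! h using 1
  ext p
  simp

/-! ### The definable almost abelian envelope. -/

/-- If, modulo `K`, no point and `n`-tuple of points centralizing all members of a family of
definable sets are such that the members of the tuple are incongruent modulo the centralizer of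
the point, then, by saturation, already a finite subfamily has this property. -/
theorem exists_finite_subfamily (hA : G.DefinableOver f A) {c : Cardinal.{w}}
    (hN : L.IsSaturated N c) (hAc : Cardinal.mk A < c)
    (K : Subgroup (G.PointsIn f)) [K.Normal] (hK : DefinableSet A (K : Set (G.PointsIn f)))
    (𝒬 : Set (Set (G.PointsIn f))) (h𝒬 : ∀ Q ∈ 𝒬, DefinableSet A Q) (n : ℕ)
    (h : ∀ (d : G.PointsIn f) (b : Fin n → G.PointsIn f),
      (∀ Q ∈ 𝒬, d ∈ K.centralizerMod Q ∧ ∀ j, b j ∈ K.centralizerMod Q) →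
        ∃ i j, i ≠ j ∧ ⁅(b i)⁻¹ * b j, d⁆ ∈ K) :
    ∃ 𝒬₁ ⊆ 𝒬, 𝒬₁.Finite ∧ ∀ (d : G.PointsIn f) (b : Fin n → G.PointsIn f),
      (∀ Q ∈ 𝒬₁, d ∈ K.centralizerMod Q ∧ ∀ j, b j ∈ K.centralizerMod Q) →
        ∃ i j, i ≠ j ∧ ⁅(b i)⁻¹ * b j, d⁆ ∈ K := by
  by_contra! hcon
  -- The partial type to realize: `R₀` expresses pairwise incongruence of the `b j`, and `R Q` that
  -- `d` and all `b j` centralize `Q` modulo `K`.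
  let R₀ : Set (Unit ⊕ Fin n → G.PointsIn f) :=
    ⋂ ij : {ij : Fin n × Fin n // ij.1 ≠ ij.2},
      {p | ⁅(p (.inr ij.1.1))⁻¹ * p (.inr ij.1.2), p (.inl ())⁆ ∈ (K : Set (G.PointsIn f))}ᶜ
  have hR₀ : DefinableRel A R₀ := DefinableRel.iInter hA fun ij => DefinableRel.compl hA
    (hK.mem hA ((((definableTerm_proj hA _).inv hA).mul hA (definableTerm_proj hA _)).commutator hA
      (definableTerm_proj hA _)))
  let R : Set (G.PointsIn f) → Set (Unit ⊕ Fin n → G.PointsIn f) := fun Q =>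
    ⋂ i, {p | p i ∈ (K.centralizerMod Q : Set (G.PointsIn f))}
  have hR : ∀ Q ∈ 𝒬, DefinableRel A (R Q) := fun Q hQ => DefinableRel.iInter hA fun i =>
    (DefinableSet.centralizerMod hA K hK (h𝒬 Q hQ)).mem hA (definableTerm_proj hA i)
  obtain ⟨p, hp⟩ := exists_mem_of_isSaturated hN hAc (𝒮 := insert R₀ (R '' 𝒬))
    (by
      rintro _ (rfl | ⟨Q, hQ, rfl⟩)
      exacts [hR₀, hR Q hQ])
    (Set.insert_nonempty _ _)
    (by
      intro 𝒯 h𝒯 h𝒯fin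
      obtain ⟨𝒬₁, h𝒬₁, h𝒬₁fin, heq⟩ := Set.exists_subset_image_finite_and.1
        ⟨𝒯 \ {R₀}, Set.sdiff_singleton_subset_iff.2 h𝒯, h𝒯fin.sdiff, rfl⟩
      obtain ⟨d, b, hdb, hbad⟩ := hcon 𝒬₁ h𝒬₁ h𝒬₁fin
      refine ⟨Sum.elim (fun _ => d) b, fun S hS => ?_⟩
      by_cases hSR : S = R₀
      · rw [hSR]
        exact Set.mem_iInter.2 fun ij => hbad _ _ ij.2
      · have : S ∈ R '' 𝒬₁ := by
          rw [← heq]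
          exact ⟨hS, hSR⟩
        obtain ⟨Q, hQ, rfl⟩ := this
        refine Set.mem_iInter.2 fun i => ?_
        rcases i with i | i
        exacts [(hdb Q hQ).1, (hdb Q hQ).2 i])
  obtain ⟨i, j, hij, hK'⟩ := h (p (.inl ())) (fun j => p (.inr j)) fun Q hQ => by
    have := Set.mem_iInter.1 (hp _ (Set.mem_insert_of_mem _ ⟨Q, hQ, rfl⟩))
    exact ⟨this _, fun j => this _⟩
  exact Set.mem_iInter.1 (hp _ (Set.mem_insert _ _)) ⟨(i, j), hij⟩ hK'

/-- A family of definable conjugation invariant sets of points commuting with each other modulo a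
definable normal subgroup `K` is contained in a definable normal subgroup which is almost abelian
modulo `K`. -/
theorem exists_definable_almost_abelian {T : L.Theory} (hT : T.NTP2) [Nonempty N] (hNT : N ⊨ T)
    (hA : G.DefinableOver f A) {c : Cardinal.{w}} (hN : L.IsSaturated N c)
    (K : Subgroup (G.PointsIn f)) [K.Normal] (hK : DefinableSet A (K : Set (G.PointsIn f)))
    (𝒬 : Set (Set (G.PointsIn f))) (h𝒬 : ∀ Q ∈ 𝒬, DefinableSet A Q)
    (hconj : ∀ Q ∈ 𝒬, ∀ x ∈ Q, ∀ g, g * x * g⁻¹ ∈ Q)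
    (hcomm : ∀ Q ∈ 𝒬, ∀ Q' ∈ 𝒬, ∀ x ∈ Q, ∀ y ∈ Q', ⁅x, y⁆ ∈ K)
    (hsmall : 𝒬.Finite ∨ ∀ B : Set N, B.Finite → Cardinal.mk (A ∪ B : Set N) < c) :
    ∃ S : Subgroup (G.PointsIn f), S.Normal ∧ K ≤ S ∧ (∀ Q ∈ 𝒬, Q ⊆ S) ∧
      (∃ B : Set N, B.Finite ∧ DefinableSet (A ∪ B) (S : Set (G.PointsIn f))) ∧
      ∃ n : ℕ, ∀ d ∈ S, ∀ b : Fin n → G.PointsIn f, (∀ j, b j ∈ S) →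
        ∃ i j, i ≠ j ∧ ⁅(b i)⁻¹ * b j, d⁆ ∈ K := by
  obtain ⟨n, hn⟩ := exists_bound_of_NTP2 hT hNT hA K hK
  let Z : Set (G.PointsIn f) := {z | ∀ Q ∈ 𝒬, z ∈ K.centralizerMod Q}
  let conj : G.PointsIn f → Set (G.PointsIn f) := fun e => {x | ∃ g, x = g * e * g⁻¹}
  -- If no finite `E` works, an `n` by `n` array of the kind excluded by NTP₂ can be built. Whole
  -- conjugacy classes of elements of `E` are centralized in order that `S` be normal.
  obtain ⟨E, hEZ, hEfin, hE⟩ : ∃ E ⊆ Z, E.Finite ∧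
      ∀ (d : G.PointsIn f) (b : Fin n → G.PointsIn f),
        (∀ Q ∈ 𝒬 ∪ conj '' E, d ∈ K.centralizerMod Q ∧ ∀ j, b j ∈ K.centralizerMod Q) →
          ∃ i j, i ≠ j ∧ ⁅(b i)⁻¹ * b j, d⁆ ∈ K := by
    by_contra! hcon
    obtain ⟨d, b, -, hdb, hrow⟩ := exists_commuting_array (QuotientGroup.mk' K) Z n (by
      intro E hEZ hEfin
      obtain ⟨d, b, hdb, hbad⟩ := hcon E hEZ hEfin
      refine ⟨d, fun Q hQ => (hdb Q (Or.inl hQ)).1, b, fun j Q hQ => (hdb Q (Or.inl hQ)).2 j,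
        fun e he => ?_, fun j j' hne => ?_⟩
      · have h := hdb (conj e) (Or.inr ⟨e, he, rfl⟩)
        have hee : e ∈ conj e := ⟨1, by simp⟩
        exact ⟨(K.commutatorElement_mem_iff_commute _ _).1
            (Subgroup.mem_centralizerMod.1 h.1 e hee),
          fun j => (K.commutatorElement_mem_iff_commute _ _).1
            (Subgroup.mem_centralizerMod.1 (h.2 j) e hee)⟩
      · exact fun h => hbad j j' hne ((K.commutatorElement_mem_iff_commute _ _).2 h)) n
    refine hn d (fun i j => if h : j < n then b i ⟨j, h⟩ else 1) ?_ ?_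
    · intro i hi j hj j' hj' hne
      simp only [hj, hj', dif_pos, Subgroup.commutatorElement_mem_iff_commute]
      exact hrow i hi _ _ (by simpa using hne)
    · intro g hg
      -- The product of the chosen entries, formed in the quotient by `K` where they commute, solves
      -- the path.
      obtain ⟨y, hy⟩ := exists_commute_inv_mul n
        (fun i => QuotientGroup.mk' K (if h : g i < n then b i ⟨g i, h⟩ else 1))
        (fun i => QuotientGroup.mk' K (d i)) (by
          intro i hi i' hi' hne
          simp only [hg i hi, hg i' hi', dif_pos]
          exact ⟨(hdb i hi i' hi' hne _).2 _, (hdb i hi i' hi' hne _).1⟩)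
      obtain ⟨x, rfl⟩ := QuotientGroup.mk'_surjective K y
      refine ⟨x, fun i hi => ?_⟩
      rw [Subgroup.commutatorElement_mem_iff_commute]
      exact hy i hi
  let B : Set N := ⋃ e ∈ E, Set.range e.1
  have hB : B.Finite := hEfin.biUnion fun e _ => Set.finite_range _
  have hAB : G.DefinableOver f (A ∪ B) := hA.mono Set.subset_union_left
  have hKB := hK.mono (Set.subset_union_left (t := B))
  have h𝒬B : ∀ Q ∈ 𝒬 ∪ conj '' E, DefinableSet (A ∪ B) Q := by
    rintro Q (hQ | ⟨e, he, rfl⟩)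
    · exact (h𝒬 Q hQ).mono Set.subset_union_left
    · exact definableSet_conjugates hAB ((Set.subset_biUnion_of_mem (u := fun e => Set.range e.1)
        he).trans Set.subset_union_right)
  obtain ⟨𝒬₁, h𝒬₁, h𝒬₁fin, hbound⟩ : ∃ 𝒬₁ ⊆ 𝒬 ∪ conj '' E, 𝒬₁.Finite ∧
      ∀ (d : G.PointsIn f) (b : Fin n → G.PointsIn f),
        (∀ Q ∈ 𝒬₁, d ∈ K.centralizerMod Q ∧ ∀ j, b j ∈ K.centralizerMod Q) →
          ∃ i j, i ≠ j ∧ ⁅(b i)⁻¹ * b j, d⁆ ∈ K := by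
    rcases hsmall with hfin | hsmall
    -- For a finite family nothing has to be extracted, so no saturation is used.
    · exact ⟨_, subset_rfl, hfin.union (hEfin.image _), hE⟩
    · exact exists_finite_subfamily hAB hN (hsmall B hB) K hKB _ h𝒬B n hE
  have hconj₁ : ∀ Q ∈ 𝒬 ∪ conj '' E, ∀ x ∈ Q, ∀ g, g * x * g⁻¹ ∈ Q := by
    rintro Q (hQ | ⟨e, he, rfl⟩)
    · exact hconj Q hQ
    · rintro _ ⟨h, rfl⟩ g
      exact ⟨g * h, by group⟩
  refine ⟨⨅ Q ∈ 𝒬₁, K.centralizerMod Q, ?_, ?_, ?_, ⟨B, hB, ?_⟩, n, ?_⟩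
  · exact Subgroup.normal_iInf_normal fun Q => Subgroup.normal_iInf_normal fun hQ =>
      K.normal_centralizerMod (hconj₁ Q (h𝒬₁ hQ))
  · exact le_iInf₂ fun Q _ => K.le_centralizerMod Q
  · intro Q hQ x hx
    simp only [SetLike.mem_coe, Subgroup.mem_iInf]
    intro Q' hQ'
    rw [Subgroup.mem_centralizerMod]
    rcases h𝒬₁ hQ' with hQ' | ⟨e, he, rfl⟩
    · exact hcomm Q hQ Q' hQ' x hx
    -- As `Q` is conjugation invariant, its centralizer modulo `K` is normal, so it contains the
    -- conjugates of `e` along with `e`.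
    · have he' : e ∈ K.centralizerMod Q := hEZ he Q hQ
      rintro _ ⟨g, rfl⟩
      have := (K.normal_centralizerMod (hconj Q hQ)).conj_mem e he' g
      rw [Subgroup.mem_centralizerMod] at this
      have h := this x hx
      rw [Subgroup.commutatorElement_mem_iff_commute] at h ⊢
      exact h.symm
  · exact DefinableSet.biInter hAB h𝒬₁fin fun Q hQ =>
      DefinableSet.centralizerMod hAB K hKB (h𝒬B Q (h𝒬₁ hQ))
  · intro d hd b hb
    simp only [Subgroup.mem_iInf] at hd hb
    exact hbound d b fun Q hQ => ⟨hd Q hQ, fun j => hb j Q hQ⟩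

end DefinableGroup

/-! ### From uniform index bounds to almost series. -/

theorem isAlmostAbelian_quotient {X : Type*} [Group X] (A B : Subgroup X)
    [(A.subgroupOf B).Normal] (n : ℕ)
    (h : ∀ d ∈ B, ∀ b : Fin n → X, (∀ j, b j ∈ B) → ∃ i j, i ≠ j ∧ ⁅(b i)⁻¹ * b j, d⁆ ∈ A) :
    IsAlmostAbelian (B ⧸ A.subgroupOf B) := by
  intro g
  refine Subgroup.finiteIndex_centralizer_of_forall_commute g n fun b => ?_
  obtain ⟨d, rfl⟩ := QuotientGroup.mk_surjective g
  choose b' hb' using fun j => QuotientGroup.mk_surjective (b j)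
  obtain ⟨i, j, hij, hA⟩ := h d d.2 (fun j => b' j) fun j => (b' j).2
  refine ⟨i, j, hij, ?_⟩
  rw [← hb' i, ← hb' j]
  exact ((A.subgroupOf B).commutatorElement_mem_iff_commute ((b' i)⁻¹ * b' j) d).1
    (Subgroup.mem_subgroupOf.2 hA)

/-- Normal subgroups `1 = s 0 ≤ ⋯ ≤ s n`, each almost abelian, with a uniform bound on indices,
modulo the previous one, form an almost series of `s n`. -/
theorem isAlmostSeries_subgroupOf {X : Type*} [Group X] (n : ℕ) (s : ℕ → Subgroup X)
    (hzero : s 0 = ⊥) (hnormal : ∀ i ≤ n, (s i).Normal) (hle : ∀ i < n, s i ≤ s (i + 1))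
    (hab : ∀ i < n, ∃ m : ℕ, ∀ d ∈ s (i + 1), ∀ b : Fin m → X, (∀ j, b j ∈ s (i + 1)) →
      ∃ j j', j ≠ j' ∧ ⁅(b j)⁻¹ * b j', d⁆ ∈ s i) :
    IsAlmostSeries n fun i : Fin (n + 1) => (s i).subgroupOf (s n) where
  normal i := (hnormal i (by omega)).subgroupOf _
  zero := by
    simp [hzero]
  last := by
    simp
  le_succ i := Subgroup.comap_mono (hle i i.2)
  quotient i := by
    have : ((s i).subgroupOf (s n)).Normal := (hnormal i (by omega)).subgroupOf _
    obtain ⟨m, hm⟩ := hab i i.2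
    refine isAlmostAbelian_quotient ((s i).subgroupOf (s n)) _ m fun d hd b hb => ?_
    exact hm d hd (fun j => b j) hb

/-! ### The definable derived family of `H` and the construction of the series. -/

namespace DefinableGroup

variable {L : FirstOrder.Language.{u, v}} {M N : Type w} [L.Structure M] [L.Structure N] {k : ℕ}
variable {G : DefinableGroup L M k} {f : M ↪ₑ[L] N} {A : Set N}

/-- Uniformly definable pieces, in `N`, of the derived series of the normal closure of `H`: the
conjugacy classes of the elements of `H`, and then the sets of conjugates of commutators of
elements of two pieces of the previous level. -/
def derivedFamily (f : M ↪ₑ[L] N) (H : Subgroup G.Points) : ℕ → Set (Set (G.PointsIn f))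
  | 0 => (fun h => {x | ∃ g, x = g * G.incl f h * g⁻¹}) '' H
  | j + 1 => Set.image2 (fun Q Q' => {z | ∃ x ∈ Q, ∃ y ∈ Q', ∃ g, z = g * ⁅x, y⁆ * g⁻¹})
      (derivedFamily f H j) (derivedFamily f H j)

theorem finite_derivedFamily {H : Subgroup G.Points} (hH : (H : Set G.Points).Finite) (j : ℕ) :
    (derivedFamily f H j).Finite := by
  induction j with
  | zero => exact hH.image _
  | succ j ih => exact ih.image2 _ ih

theorem conj_mem_of_mem_derivedFamily {H : Subgroup G.Points} {j : ℕ} {Q : Set (G.PointsIn f)}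
    (hQ : Q ∈ derivedFamily f H j) {x : G.PointsIn f} (hx : x ∈ Q) (g : G.PointsIn f) :
    g * x * g⁻¹ ∈ Q := by
  cases j with
  | zero =>
    obtain ⟨h, -, rfl⟩ := hQ
    obtain ⟨g', rfl⟩ := hx
    exact ⟨g * g', by group⟩
  | succ j =>
    obtain ⟨Q₁, -, Q₂, -, rfl⟩ := hQ
    obtain ⟨a, ha, b, hb, g', rfl⟩ := hx
    exact ⟨a, ha, b, hb, g * g', by simp only [mul_inv_rev, mul_assoc]⟩

theorem definableSet_of_mem_derivedFamily (hA : G.DefinableOver f A) {H : Subgroup G.Points}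
    (hH : ∀ h ∈ H, Set.range (G.incl f h).1 ⊆ A) {j : ℕ} {Q : Set (G.PointsIn f)}
    (hQ : Q ∈ derivedFamily f H j) : DefinableSet A Q := by
  induction j generalizing Q with
  | zero =>
    obtain ⟨h, hh, rfl⟩ := hQ
    exact definableSet_conjugates hA (hH h hh)
  | succ j ih =>
    obtain ⟨Q₁, hQ₁, Q₂, hQ₂, rfl⟩ := hQ
    have h : DefinableRel A ({p : Unit ⊕ Fin 3 → G.PointsIn f | p (.inr 0) ∈ Q₁} ∩
        ({p | p (.inr 1) ∈ Q₂} ∩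
          {p | p (.inl ()) = p (.inr 2) * ⁅p (.inr 0), p (.inr 1)⁆ * (p (.inr 2))⁻¹})) :=
      ((ih hQ₁).mem hA (definableTerm_proj hA _)).inter
        (((ih hQ₂).mem hA (definableTerm_proj hA _)).inter
          ((definableTerm_proj hA _).eq hA ((definableTerm_proj hA _).conj hA
            ((definableTerm_proj hA _).commutator hA (definableTerm_proj hA _)))))
    rw [DefinableSet]
    convert! h.exists using 1
    ext p
    constructor
    · rintro ⟨x, hx, y, hy, g, h⟩
      exact ⟨![x, y, g], hx, hy, h⟩
    · rintro ⟨q, hx, hy, h⟩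
      exact ⟨_, hx, _, hy, _, h⟩

theorem incl_injective : Function.Injective (G.incl f) := fun x y h => by
  refine Subtype.ext (funext fun j => f.injective ?_)
  exact congrFun (congrArg Subtype.val h) j

/-- By elementarity, the points in `M` of the `j`-th level of the derived family of `H` belong to
the `j`-th derived subgroup of `H`. -/
theorem mem_derivedSeries_of_mem_derivedFamily (hA : G.DefinableOver f A)
    (hAf : A ⊆ Set.range f) {H : Subgroup G.Points} [H.Normal]
    (hH : ∀ h ∈ H, Set.range (G.incl f h).1 ⊆ A) {j : ℕ} {Q : Set (G.PointsIn f)}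
    (hQ : Q ∈ derivedFamily f H j) {z : G.Points} (hz : G.incl f z ∈ Q) :
    z ∈ (derivedSeries H j).map H.subtype := by
  have hAr : G.DefinableOver f (Set.range f) := hA.mono hAf
  have hzr : Set.range (G.incl f z).1 ⊆ Set.range f := by
    rintro _ ⟨i, rfl⟩
    exact ⟨z.1 i, rfl⟩
  induction j generalizing Q z with
  | zero =>
    obtain ⟨h, hh, hz⟩ := hQ
    subst hz
    have hR : DefinableRel (Set.range f) {p : Unit → G.PointsIn f |
        G.incl f z = p () * G.incl f h * (p ())⁻¹} :=
      (definableTerm_const hAr hzr).eq hAr ((definableTerm_proj hAr _).conj hAr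
        (definableTerm_const hAr ((hH h hh).trans hAf)))
    obtain ⟨g, hg⟩ := hz
    -- The conjugating element can be taken in `M`, where `H` is normal.
    obtain ⟨p, hp⟩ := hR.exists_incl ⟨fun _ => g, hg⟩
    have hzp : z = p () * h * (p ())⁻¹ := incl_injective (f := f) (by
      rw [map_mul, map_mul, map_inv]
      exact hp)
    rw [derivedSeries_zero, ← MonoidHom.range_eq_map, Subgroup.range_subtype, hzp]
    exact ‹H.Normal›.conj_mem h hh _
  | succ j ih =>
    obtain ⟨Q₁, hQ₁, Q₂, hQ₂, rfl⟩ := hQ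
    have hdef : ∀ Q ∈ derivedFamily f H j, DefinableSet (Set.range f) Q := fun Q hQ =>
      (definableSet_of_mem_derivedFamily hA hH hQ).mono hAf
    have hR : DefinableRel (Set.range f) ({p : Fin 3 → G.PointsIn f | p 0 ∈ Q₁} ∩
        ({p | p 1 ∈ Q₂} ∩ {p | G.incl f z = p 2 * ⁅p 0, p 1⁆ * (p 2)⁻¹})) :=
      ((hdef _ hQ₁).mem hAr (definableTerm_proj hAr _)).inter
        (((hdef _ hQ₂).mem hAr (definableTerm_proj hAr _)).inter
          ((definableTerm_const hAr hzr).eq hAr ((definableTerm_proj hAr _).conj hAr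
            ((definableTerm_proj hAr _).commutator hAr (definableTerm_proj hAr _)))))
    obtain ⟨x, hx, y, hy, g, hg⟩ := hz
    obtain ⟨p, hp0, hp1, hp2⟩ := hR.exists_incl ⟨![x, y, g], hx, hy, hg⟩
    have hzp : z = p 2 * ⁅p 0, p 1⁆ * (p 2)⁻¹ := incl_injective (f := f) (by
      rw [map_mul, map_mul, map_inv, map_commutatorElement]
      exact hp2)
    have h0 := ih hQ₁ hp0 (by rintro _ ⟨i, rfl⟩; exact ⟨(p 0).1 i, rfl⟩)
    have h1 := ih hQ₂ hp1 (by rintro _ ⟨i, rfl⟩; exact ⟨(p 1).1 i, rfl⟩)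
    -- Derived subgroups are characteristic in `H`, which is normal in `G`.
    have hn : ((derivedSeries H (j + 1)).map H.subtype).Normal := inferInstance
    rw [hzp]
    refine hn.conj_mem _ ?_ _
    rw [derivedSeries_succ, Subgroup.map_commutator]
    exact Subgroup.commutator_mem_commutator h0 h1

/-- A nontrivial element of such a piece would, by elementarity, yield a nontrivial one coming from
`M`, which would lie in the `n`-th derived subgroup of `H`. -/
theorem eq_one_of_mem_derivedFamily (hA : G.DefinableOver f A)
    (hAf : A ⊆ Set.range f) {H : Subgroup G.Points} [H.Normal]
    (hH : ∀ h ∈ H, Set.range (G.incl f h).1 ⊆ A) {n : ℕ} (hn : derivedSeries H n = ⊥)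
    {Q : Set (G.PointsIn f)} (hQ : Q ∈ derivedFamily f H n) {x : G.PointsIn f} (hx : x ∈ Q) :
    x = 1 := by
  by_contra hne
  have hAr : G.DefinableOver f (Set.range f) := hA.mono hAf
  have hR : DefinableRel (Set.range f) ({p : Unit → G.PointsIn f | p () ∈ Q} ∩ {p | p () = 1}ᶜ) :=
    ((definableSet_of_mem_derivedFamily hA hH hQ).mono hAf).inter
      (((definableTerm_proj hAr _).eq hAr (definableTerm_one hAr)).compl hAr)
  obtain ⟨p, hp, hp1⟩ := hR.exists_incl ⟨fun _ => x, hx, hne⟩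
  have := mem_derivedSeries_of_mem_derivedFamily hA hAf hH hQ hp
  rw [hn, Subgroup.map_bot, Subgroup.mem_bot] at this
  refine hp1 ?_
  simp [this]

/-- Take the finitely many parameters of `G` and the coordinates of the elements of `H`. For
infinite `H`, neither the `k` coordinates nor finitely many extra parameters exceed its cardinality;
for finite `H` they may. -/
theorem exists_parameters (f : M ↪ₑ[L] N) (H : Subgroup G.Points) :
    ∃ A : Set N, A ⊆ Set.range f ∧ G.DefinableOver f A ∧
      (∀ h ∈ H, Set.range (G.incl f h).1 ⊆ A) ∧
      (Infinite H → ∀ B : Set N, B.Finite →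
        Cardinal.mk (A ∪ B : Set N) < Order.succ (Cardinal.mk H)) := by
  obtain ⟨P, hPfin, hPf, hP⟩ := exists_finite_definableOver G f
  refine ⟨P ∪ Set.range fun x : H × Fin k => (G.incl f x.1).1 x.2, ?_,
    hP.mono Set.subset_union_left, ?_, ?_⟩
  · refine Set.union_subset hPf ?_
    rintro _ ⟨⟨h, i⟩, rfl⟩
    exact ⟨h.1.1 i, rfl⟩
  · rintro h hh _ ⟨i, rfl⟩
    exact Or.inr ⟨(⟨h, hh⟩, i), rfl⟩
  · intro hinf B hB
    have h0 : Cardinal.aleph0 ≤ Cardinal.mk H := Cardinal.aleph0_le_mk H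
    have hfin : ∀ C : Set N, C.Finite → Cardinal.mk C ≤ Cardinal.mk H := fun C hC =>
      (Cardinal.lt_aleph0_iff_set_finite.2 hC).le.trans h0
    have hprod : Cardinal.mk (H × Fin k) ≤ Cardinal.mk H := by
      rw [Cardinal.mk_prod, Cardinal.lift_uzero, Cardinal.mk_fin, Cardinal.lift_natCast]
      exact Cardinal.mul_le_of_le h0 le_rfl ((Cardinal.natCast_lt_aleph0).le.trans h0)
    rw [Order.lt_succ_iff]
    exact (Cardinal.mk_union_le _ _).trans (Cardinal.add_le_of_le h0
      ((Cardinal.mk_union_le _ _).trans (Cardinal.add_le_of_le h0 (hfin P hPfin)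
        (Cardinal.mk_range_le.trans hprod))) (hfin B hB))

/-- The definable normal almost series, of any length `m ≤ n`, whose `i`-th member contains the
level `n - i` of the derived family of `H`. -/
theorem exists_almost_series {T : L.Theory} (hT : T.NTP2) [Nonempty N] (hNT : N ⊨ T)
    {H : Subgroup G.Points} [H.Normal] {n : ℕ} (hn : derivedSeries H n = ⊥)
    (hN : L.IsSaturated N (Order.succ (Cardinal.mk H))) (m : ℕ) (hm : m ≤ n) :
    ∃ s : ℕ → Subgroup (G.PointsIn f), s 0 = ⊥ ∧ (∀ i ≤ m, (s i).Normal ∧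
        (∃ A : Set N, DefinableSet A (s i : Set (G.PointsIn f))) ∧
        ∀ Q ∈ derivedFamily f H (n - i), Q ⊆ s i) ∧
      ∀ i < m, s i ≤ s (i + 1) ∧ ∃ l : ℕ, ∀ d ∈ s (i + 1), ∀ b : Fin l → G.PointsIn f,
        (∀ j, b j ∈ s (i + 1)) → ∃ j j', j ≠ j' ∧ ⁅(b j)⁻¹ * b j', d⁆ ∈ s i := by
  obtain ⟨A, hAf, hA, hAH, hAc⟩ := exists_parameters f H
  suffices ∃ s : ℕ → Subgroup (G.PointsIn f), s 0 = ⊥ ∧ (∀ i ≤ m, (s i).Normal ∧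
        (∃ B : Set N, B.Finite ∧ DefinableSet (A ∪ B) (s i : Set (G.PointsIn f))) ∧
        ∀ Q ∈ derivedFamily f H (n - i), Q ⊆ s i) ∧
      ∀ i < m, s i ≤ s (i + 1) ∧ ∃ l : ℕ, ∀ d ∈ s (i + 1), ∀ b : Fin l → G.PointsIn f,
        (∀ j, b j ∈ s (i + 1)) → ∃ j j', j ≠ j' ∧ ⁅(b j)⁻¹ * b j', d⁆ ∈ s i by
    obtain ⟨s, h0, h1, h2⟩ := this
    exact ⟨s, h0, fun i hi => ⟨(h1 i hi).1, ⟨_, (h1 i hi).2.1.choose_spec.2⟩, (h1 i hi).2.2⟩, h2⟩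
  induction m with
  | zero =>
    refine ⟨fun _ => ⊥, rfl, fun i hi => ?_, by simp⟩
    obtain rfl : i = 0 := by omega
    refine ⟨inferInstance, ⟨∅, Set.finite_empty, ?_⟩, fun Q hQ x hx =>
      eq_one_of_mem_derivedFamily hA hAf hAH hn hQ hx⟩
    have hA' := hA.mono (Set.subset_union_left (t := ∅))
    exact (definableTerm_proj hA' ()).eq hA' (definableTerm_one hA')
  | succ m ih =>
    obtain ⟨s, hs0, hs, hsle⟩ := ih (by omega)
    obtain ⟨hnormal, ⟨B, hB, hdef⟩, hQ⟩ := hs m le_rfl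
    have hAB : G.DefinableOver f (A ∪ B) := hA.mono Set.subset_union_left
    obtain ⟨S, hSn, hKS, hQS, ⟨B', hB', hSdef⟩, l, hl⟩ := exists_definable_almost_abelian hT hNT
      hAB hN (s m) hdef (derivedFamily f H (n - (m + 1)))
      (fun Q hQ => (definableSet_of_mem_derivedFamily hA hAH hQ).mono Set.subset_union_left)
      (fun Q hQ x hx g => conj_mem_of_mem_derivedFamily hQ hx g)
      (by
        intro Q₁ hQ₁ Q₂ hQ₂ x hx y hy
        -- Commutators between pieces of level `n - (m + 1)` lie in pieces of level `n - m`, with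
        -- conjugating element 1, hence in `s m`.
        have hnm : n - m = n - (m + 1) + 1 := by omega
        rw [hnm] at hQ
        exact hQ _ ⟨Q₁, hQ₁, Q₂, hQ₂, rfl⟩ ⟨x, hx, y, hy, 1, by simp⟩)
      (by
        -- A finite `H` has finite derived families; for infinite `H` the parameters, with those
        -- added at earlier stages, remain few enough for saturation.
        rcases finite_or_infinite H with hfin | hinf
        · exact Or.inl (finite_derivedFamily (Set.toFinite _) _)
        · refine Or.inr fun C hC => ?_
          rw [Set.union_assoc]
          exact hAc hinf _ (hB.union hC))
    refine ⟨Function.update s (m + 1) S, by simpa using hs0, fun i hi => ?_, fun i hi => ?_⟩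
    · rcases hi.lt_or_eq with hi | rfl
      · simpa [hi.ne] using hs i (by omega)
      · rw [Function.update_self]
        refine ⟨hSn, ⟨B ∪ B', hB.union hB', ?_⟩, hQS⟩
        rwa [← Set.union_assoc]
    · rcases (Nat.lt_succ_iff_lt_or_eq.1 hi) with hi | rfl
      · rw [Function.update_of_ne (by omega), Function.update_of_ne (by omega)]
        exact hsle i hi
      · rw [Function.update_self, Function.update_of_ne (by omega)]
        exact ⟨hKS, l, hl⟩

end DefinableGroup

theorem proposition3p6 {L : FirstOrder.Language.{u, v}} (T : L.Theory) (hT : T.NTP2)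
    {M N : Type w} [L.Structure M] [L.Structure N] [Nonempty M] (hM : M ⊨ T)
    {k : ℕ} (G : DefinableGroup L M k) (H : Subgroup G.Points) (hHnormal : H.Normal)
    (n : ℕ) (hHsolvable : derivedSeries H n = ⊥)
    (f : M ↪ₑ[L] N) (hN : L.IsSaturated N (Order.succ (Cardinal.mk H))) :
    ∃ S : Subgroup (G.PointsIn f),
      DefinableGroup.IsDefinable S ∧ S.Normal ∧ H.map (G.incl f) ≤ S ∧
      IsAlmostSolvable S ∧ almostSolvableClass S ≤ n ∧
      ∃ s : Fin (n + 1) → Subgroup (G.PointsIn f),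
        (∀ i, s i ≤ S ∧ DefinableGroup.IsDefinable (s i) ∧ (s i).Normal) ∧
        IsAlmostSeries n (fun i => (s i).subgroupOf S) := by
  have : Nonempty N := ‹Nonempty M›.map f
  have hNT : N ⊨ T := (f.elementarilyEquivalent.theory_model_iff).1 hM
  obtain ⟨s, hs0, hs, hsle⟩ := DefinableGroup.exists_almost_series (f := f) hT hNT hHsolvable hN
    n le_rfl
  have hdef : ∀ i ≤ n, DefinableGroup.IsDefinable (s i) := fun i hi =>
    .of_definableSet (hs i hi).2.1.choose_spec
  have hseries : IsAlmostSeries n fun i : Fin (n + 1) => (s i).subgroupOf (s n) :=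
    isAlmostSeries_subgroupOf n s hs0 (fun i hi => (hs i hi).1) (fun i hi => (hsle i hi).1)
      fun i hi => (hsle i hi).2
  have hle : ∀ i ≤ n, s i ≤ s n := fun i hi =>
    Nat.le_induction (P := fun m _ => m ≤ n → s i ≤ s m) (fun _ => le_rfl)
      (fun m _ ih hm => (ih (by omega)).trans (hsle m hm).1) n hi le_rfl
  refine ⟨s n, hdef n le_rfl, (hs n le_rfl).1, ?_, ⟨n, _, hseries⟩, Nat.sInf_le ⟨_, hseries⟩,
    fun i => s i, fun i => ⟨hle i (by omega), hdef i (by omega), (hs i (by omega)).1⟩, hseries⟩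
  rintro _ ⟨h, hh, rfl⟩
  -- The top member contains level 0, in particular the conjugacy class of each element of `H`.
  refine (hs n le_rfl).2.2 {x | ∃ g, x = g * G.incl f h * g⁻¹} ?_ ⟨1, by simp⟩
  rw [Nat.sub_self]
  exact ⟨h, hh, rfl⟩
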